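/- Let $Q=(a,b)\subset\mathbb{R}$ be a bounded interval, $a<b$. For an interval $J$ put $\langle\psi\rangle_J=\frac1{|J|}\int_J\psi$. Let $\mathrm{BMO}(Q)$ be the set of real $\varphi\in L^1(Q)$ with $$\|\varphi\|:=\sup_{J\subseteq Q}\big(\langle\varphi^2\rangle_J-\langle\varphi\rangle_J^2\big)^{1/2}<\infty ,$$ the supremum being over all nondegenerate subintervals $J$ of $Q$ ($Q$ itself included), and write $V(\varphi)=\langle\varphi^2\rangle_Q-\langle\varphi\rangle_Q^2$. **Inequalities.** Let $\varphi\in\mathrm{BMO}(Q)$ with $\|\varphi\|\ne0$. Then $|\varphi-\langle\varphi\rangle_Q|^p$ is integrable on $Q$ for every $p>0$, and - if $0<p\le1$: $\quad 2^{p-2}\|\varphi\|^{p-2}\,V(\varphi)\le\langle|\varphi-\langle\varphi\rangle_Q|^p\rangle_Q\le V(\varphi)^{p/2}$; - if $1\le p\le2$: $\quad \frac p2\Gamma(p)\|\varphi\|^{p-2}\,V(\varphi)\le\langle|\varphi-\langle\varphi\rangle_Q|^p\rangle_Q\le V(\varphi)^{p/2}$; - if $2\le p<\infty$: $\quad V(\varphi)^{p/2}\le\langle|\varphi-\langle\varphi\rangle_Q|^p\rangle_Q\le\frac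 p2\Gamma(p)\|\varphi\|^{p-2}\,V(\varphi)$. **Sharpness.** All these inequalities are sharp and attained. Given $\varepsilon>0$, define functions of $t\in Q$, with $s=\frac{t-a}{b-a}\in(0,1)$: - $\varphi_1=-\varepsilon$ for $s<\frac12$ and $\varphi_1=\varepsilon$ for $s\ge\frac12$; - $\varphi_2=\varepsilon\log(4s)$ for $s<\frac14$, $\varphi_2=0$ for $\frac14\le s\le\frac34$, $\varphi_2=-\varepsilon\log(4-4s)$ for $s>\frac34$; - $\varphi_3=-2\varepsilon$ for $s<\frac18$, $\varphi_3=0$ for $\frac18\le s\le\frac78$, $\varphi_3=2\varepsilon$ for $s>\frac78$. Then $\varphi_k\in\mathrm{BMO}(Q)$, $\|\varphi_k\|=\varepsilon$ and $V(\varphi_k)=\varepsilon^2$ for $k=1,2,3$. Moreover $\langle|\varphi-\langle\varphi\rangle_Q|^p\rangle_Q$ equals $V(\varphi)^{p/2}$ for $\varphi=\varphi_1$ and all $p>0$; it equals $\frac p2\Gamma(p)\|\varphi\|^{p-2}V(\varphi)$ for $\varphi=\varphi_2$ and all $p\ge1$; and it equals $2^{p-2}\|\varphi\|^{p-2}V(\varphi)$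 for $\varphi=\varphi_3$ and all $0<p\le1$. -/

import Mathlib

open MeasureTheory Set

noncomputable section

/-- The average of `φ` over the interval `(a, b)`. -/
def avg (φ : ℝ → ℝ) (a b : ℝ) : ℝ := ⨍ t in Ioo a b, φ t

/-- The `p`-oscillation of `φ` over `(a, b)`: the average of `|φ - avg φ|ᵖ`. -/
def pOsc (p : ℝ) (φ : ℝ → ℝ) (a b : ℝ) : ℝ :=
  avg (fun t => |φ t - avg φ a b| ^ p) a b

/-- The `2`-oscillation (variance) of `φ` over `(a, b)`, in the form
`avg (φ²) - (avg φ)²`. -/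
def osc2 (φ : ℝ → ℝ) (a b : ℝ) : ℝ :=
  avg (fun t => φ t ^ 2) a b - avg φ a b ^ 2

/-- `φ ∈ BMO((a, b))`: `φ` is integrable on `(a, b)`, and its `2`-oscillations over all
subintervals of `(a, b)`, the whole interval included, are finite and bounded by one constant.
(The integrability of `φ²` says that the `2`-oscillation is finite.) -/
def MemBMO (φ : ℝ → ℝ) (a b : ℝ) : Prop :=
  IntegrableOn φ (Ioo a b) ∧
    ∃ C : ℝ, ∀ c d : ℝ, a ≤ c → c < d → d ≤ b →
      IntegrableOn (fun t => φ t ^ 2) (Ioo c d) ∧ osc2 φ c d ≤ C ^ 2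

/-- The `BMO` norm on `(a, b)`: the supremum, over all subintervals, of the square root of
the `2`-oscillation. It is meaningful for `φ` with `MemBMO φ a b`. -/
def bmoNorm (φ : ℝ → ℝ) (a b : ℝ) : ℝ :=
  sSup {r : ℝ | ∃ c d : ℝ, a ≤ c ∧ c < d ∧ d ≤ b ∧ r = Real.sqrt (osc2 φ c d)}

/-- The step function on `(a, b)` with values `-ε` and `ε` on the two halves. -/
def twoStep (ε a b : ℝ) (t : ℝ) : ℝ :=
  if (t - a) / (b - a) < 1 / 2 then -ε else ε

/-- The function on `(a, b)` which in the variable `s = (t - a) / (b - a) ∈ (0, 1)` is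
`ε log (4 s)` on `(0, 1/4)`, zero on `[1/4, 3/4]`, and `-ε log (4 - 4 s)` on `(3/4, 1)`. -/
def doubleLog (ε a b : ℝ) (t : ℝ) : ℝ :=
  if (t - a) / (b - a) < 1 / 4 then ε * Real.log (4 * ((t - a) / (b - a)))
  else if (t - a) / (b - a) ≤ 3 / 4 then 0
  else -ε * Real.log (4 - 4 * ((t - a) / (b - a)))

/-- The step function on `(a, b)` which in the variable `s = (t - a) / (b - a) ∈ (0, 1)` is
`-2 ε` on `(0, 1/8)`, zero on `[1/8, 7/8]`, and `2 ε` on `(7/8, 1)`. -/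
def threeStep (ε a b : ℝ) (t : ℝ) : ℝ :=
  if (t - a) / (b - a) < 1 / 8 then -(2 * ε)
  else if (t - a) / (b - a) ≤ 7 / 8 then 0
  else 2 * ε

end

open Filter Topology

/-! Everything except the Jensen bounds follows from one sharp decay estimate,
`OscBoundedBy.lintegral_truncation_sub_avg_le`: with `N` the norm, the average of `(|φ - ⟨φ⟩| -
s)₊²` over the interval is at most `exp (-s / N) * V`, for every `s ≥ 0`.

The estimate is a Bellman function argument. After scaling to norm below `1`, an interval `J` has
the Bellman point `(⟨φ⟩_J, ⟨φ²⟩_J)`, which lies in the strip `x² ≤ y ≤ x² + 1`. On this strip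
`bellman s` has boundary values `(|x| - s)₊²` on the lower parabola, equals `exp (-s) * y` on the
axis `x = 0`, and is concave along segments that stay in the strip (`bellman_concave`). Since the
bound on the oscillations is strictly below `1`, every interval can be cut, in a controlled
proportion, so that the segment joining the Bellman points of the pieces stays in the strip
(`exists_isGoodCut`). Iterated cuts give step functions whose integrals are bounded by `bellman` at
the Bellman point of the whole interval. They converge a.e. to `(|φ| - s)₊²` by Lebesgue
differentiation, and Fatou's lemma concludes.

The moments follow by integrating over `s`. For `p > 2`, `t ^ p` is a positive mixture of the
truncations `(t - s)₊²`, which gives an upper bound; for `1 < p < 2` it is a positive mixture of `t²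
- (t - s)₊²`, which gives a lower bound. The case `p = 1` comes from `s → 0`. For `p < 1` a
pointwise minorant of `u ^ p` by a combination of `u` and `u²` reduces the claim to `p = 1` and `p =
2`. The bounds by `V ^ (p / 2)` are Jensen's inequality.

For sharpness: `|twoStep|` is constant, so Jensen is an equality; `|doubleLog|` is exponentially
distributed on the two end quarters, which produces the Gamma function; `|threeStep|` takes only the
values `0` and `2 * ε`, where the minorant touches `u ^ p` after division by `2 * ε`. Their norms
are computed by comparing each oscillation with the mean square distance to a well-chosen constant.
-/

noncomputable section

/-! ### The Bellman function and its local concavity. -/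

/-- The supporting parameter of the Bellman function: the abscissa, clamped to `[0, s]`, at which
the right tangent through `(|x|, y)` to the upper parabola meets the lower parabola. -/
def bellmanCut (s x y : ℝ) : ℝ := max 0 (min s (|x| - 1 + √(1 - (y - x ^ 2))))

/-- A locally concave function on the parabolic strip `x² ≤ y ≤ x² + 1` with boundary values
`(|x| - s)₊²` on the lower parabola. -/
def bellman (s x y : ℝ) : ℝ :=
  Real.exp (bellmanCut s x y - s) * (y - 2 * bellmanCut s x y * |x| + bellmanCut s x y ^ 2)

lemma continuous_bellman (s : ℝ) : Continuous fun q : ℝ × ℝ => bellman s q.1 q.2 := by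
  unfold bellman bellmanCut
  fun_prop

lemma bellman_neg (s x y : ℝ) : bellman s (-x) y = bellman s x y := by
  simp [bellman, bellmanCut]

lemma bellmanCut_nonneg (s x y : ℝ) : 0 ≤ bellmanCut s x y := le_max_left _ _

lemma bellmanCut_le {s : ℝ} (hs : 0 ≤ s) (x y : ℝ) : bellmanCut s x y ≤ s :=
  max_le hs (min_le_left _ _)

lemma bellman_nonneg (s : ℝ) {x y : ℝ} (h : x ^ 2 ≤ y) : 0 ≤ bellman s x y := by
  unfold bellman
  have := sq_nonneg (|x| - bellmanCut s x y)
  have h2 := sq_abs x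
  exact mul_nonneg (Real.exp_pos _).le (by nlinarith)

lemma bellman_boundary {s : ℝ} (hs : 0 ≤ s) (x : ℝ) :
    bellman s x (x ^ 2) = max (|x| - s) 0 ^ 2 := by
  have h : bellmanCut s x (x ^ 2) = min s |x| := by simp [bellmanCut, hs]
  rw [bellman, h]
  rcases le_total s |x| with h1 | h1
  · rw [min_eq_left h1, max_eq_left (by linarith), sub_self, Real.exp_zero, ← sq_abs x]
    ring
  · rw [min_eq_right h1, max_eq_right (by linarith), ← sq_abs x]
    ring

lemma bellman_zero_left {s y : ℝ} (hy : 0 ≤ y) :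
    bellman s 0 y = Real.exp (-s) * y := by
  have h : bellmanCut s 0 y = 0 := by
    have : √(1 - y) ≤ 1 := by
      rw [Real.sqrt_le_one]; linarith
    rw [bellmanCut, max_eq_left]
    exact (min_le_right _ _).trans (by simpa using this)
  simp [bellman, h]

lemma hasDerivAt_exp_mul_quadratic (x y u : ℝ) :
    HasDerivAt (fun u => Real.exp u * (y - 2 * u * x + u ^ 2))
      (Real.exp u * ((u - (x - 1)) ^ 2 - (1 - (y - x ^ 2)))) u := by
  have h1 : HasDerivAt (fun u : ℝ => y - 2 * u * x + u ^ 2) (-(2 * x) + 2 * u) u := by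
    have h2 : HasDerivAt (fun u : ℝ => 2 * u * x) (2 * x) u := by
      simpa using ((hasDerivAt_id u).const_mul 2).mul_const x
    have h3 : HasDerivAt (fun u : ℝ => u ^ 2) (2 * u) u := by
      simpa using hasDerivAt_pow 2 u
    exact (h2.const_sub y).add h3
  exact ((Real.hasDerivAt_exp u).mul h1).congr_deriv (by ring)

lemma exp_mul_quadratic_monotoneOn {x y : ℝ} :
    MonotoneOn (fun u => Real.exp u * (y - 2 * u * x + u ^ 2))
      (Ici (x - 1 + √(1 - (y - x ^ 2)))) := by
  apply monotoneOn_of_deriv_nonneg (convex_Ici _) (by fun_prop) (by fun_prop)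
  intro u hu
  rw [interior_Ici, mem_Ioi] at hu
  rw [(hasDerivAt_exp_mul_quadratic x y u).deriv]
  refine mul_nonneg (Real.exp_pos _).le ?_
  have h2 : 1 - (y - x ^ 2) ≤ (u - (x - 1)) ^ 2 := by
    have := Real.sqrt_le_left (x := 1 - (y - x ^ 2)) (y := u - (x - 1))
      (by linarith [Real.sqrt_nonneg (1 - (y - x ^ 2))])
    exact this.1 (by linarith)
  linarith

lemma exp_mul_quadratic_antitoneOn {x y : ℝ} (hy : y ≤ x ^ 2 + 1) :
    AntitoneOn (fun u => Real.exp u * (y - 2 * u * x + u ^ 2))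
      (Icc (x - 1 - √(1 - (y - x ^ 2))) (x - 1 + √(1 - (y - x ^ 2)))) := by
  apply antitoneOn_of_deriv_nonpos (convex_Icc _ _) (by fun_prop) (by fun_prop)
  intro u hu
  rw [interior_Icc, mem_Ioo] at hu
  rw [(hasDerivAt_exp_mul_quadratic x y u).deriv]
  refine mul_nonpos_of_nonneg_of_nonpos (Real.exp_pos _).le ?_
  have h1 := Real.sq_sqrt (show 0 ≤ 1 - (y - x ^ 2) by linarith)
  nlinarith [hu.1, hu.2]

/-- With `r = √(1 - (y - x²))`, the function `exp u * (y - 2 * u * x + u²)` has a local maximum at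
`x - 1 - r` and a local minimum at `x - 1 + r`. So `bellmanCut` is its minimiser on `[0, s]` once
the parameters to the left of the local maximum are discarded, which is the role of `hu`. -/
lemma bellman_le_of_nonneg {s x y u : ℝ} (hx : 0 ≤ x) (hy : y ≤ x ^ 2 + 1)
    (hu0 : 0 ≤ u) (hus : u ≤ s) (hu : min (x - 1 - √(1 - (y - x ^ 2))) s ≤ u) :
    bellman s x y ≤ Real.exp (u - s) * (y - 2 * u * x + u ^ 2) := by
  set r := √(1 - (y - x ^ 2)) with hr
  have hr0 : 0 ≤ r := Real.sqrt_nonneg _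
  set v := bellmanCut s x y with hv
  have hv' : v = max 0 (min s (x - 1 + r)) := by rw [hv, bellmanCut, abs_of_nonneg hx]
  have key : Real.exp v * (y - 2 * v * x + v ^ 2) ≤ Real.exp u * (y - 2 * u * x + u ^ 2) := by
    rcases le_or_gt (x - 1 + r) u with h | h
    · refine exp_mul_quadratic_monotoneOn (x := x) (y := y) (a := v) (b := u) ?_ h ?_
      · rw [mem_Ici, hv', ← hr, min_eq_right (h.trans hus)]
        exact le_max_right _ _
      · rw [hv', max_le_iff, min_le_iff]; exact ⟨hu0, Or.inr h⟩
    · have hv2 : v = min s (x - 1 + r) := by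
        rw [hv', max_eq_right]; exact le_min (hu0.trans hus) (hu0.trans h.le)
      rcases min_le_iff.1 hu with h1 | h1
      · have huv : u ≤ v := by rw [hv2]; exact le_min hus h.le
        refine exp_mul_quadratic_antitoneOn hy (a := u) (b := v) ⟨h1, h.le⟩ ⟨h1.trans huv, ?_⟩ huv
        rw [hv2]; exact min_le_right _ _
      · have : v = u := by
          have hsu := le_antisymm h1 hus
          rw [hv2, min_eq_left (by linarith), hsu]
        rw [this]
  have e : ∀ w : ℝ, Real.exp (w - s) = Real.exp (-s) * Real.exp w := fun w => by
    rw [← Real.exp_add]; ring_nf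
  rw [bellman, ← hv, abs_of_nonneg hx, e v, e u, mul_assoc (Real.exp (-s)), mul_assoc (Real.exp (-s))]
  exact mul_le_mul_of_nonneg_left key (Real.exp_pos _).le

/-- The right side is affine in `(y₁, y₂)` and agrees with `bellman` at `(x₁, x₂)`, so this is a
supporting plane. Hypothesis `h` says that the segment between the points stays below the upper
parabola: the parabola minus the line is a monic quadratic in the abscissa whose values at the ends
are the squares of the two roots. It yields `y₁ - 1 - √(1 - (y₂ - y₁²)) ≤ x₁ - 1 + √(1 - (x₂ -
x₁²))`, so the cut of the first point is an admissible parameter for the second. -/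
lemma bellman_le_supporting {s x₁ x₂ y₁ y₂ : ℝ} (hs : 0 ≤ s) (hx : 0 ≤ x₁) (hx' : x₁ ^ 2 ≤ x₂)
    (hy : y₁ ^ 2 ≤ y₂) (hy' : y₂ ≤ y₁ ^ 2 + 1)
    (h : |x₁ - y₁| ≤ √(1 - (x₂ - x₁ ^ 2)) + √(1 - (y₂ - y₁ ^ 2))) :
    bellman s y₁ y₂ ≤ Real.exp (bellmanCut s x₁ x₂ - s) *
      (y₂ - 2 * bellmanCut s x₁ x₂ * y₁ + bellmanCut s x₁ x₂ ^ 2) := by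
  have hU0 := bellmanCut_nonneg s x₁ x₂
  have hUs := bellmanCut_le hs x₁ x₂
  rcases le_total 0 y₁ with h0 | h0
  · refine bellman_le_of_nonneg h0 hy' hU0 hUs ?_
    have : min s (|x₁| - 1 + √(1 - (x₂ - x₁ ^ 2))) ≤ bellmanCut s x₁ x₂ := le_max_right _ _
    refine le_trans ?_ this
    rw [abs_of_nonneg hx, min_comm]
    refine min_le_min le_rfl ?_
    have := neg_le_of_abs_le h
    linarith
  · set U := bellmanCut s x₁ x₂
    have hr : √(1 - (x₂ - x₁ ^ 2)) ≤ 1 := by rw [Real.sqrt_le_one]; linarith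
    -- On the other side of the axis the parameter `0` is used; it is admissible because the first
    -- root is at most `1`. For `y₁ ≤ 0` raising the parameter from `0` to `U` only increases the
    -- plane.
    have h1 : bellman s (-y₁) y₂ ≤ Real.exp (0 - s) * (y₂ - 2 * 0 * (-y₁) + 0 ^ 2) := by
      refine bellman_le_of_nonneg (by linarith) (by linarith [neg_sq y₁]) le_rfl hs ?_
      refine (min_le_left _ _).trans ?_
      rw [neg_sq]
      have := le_of_abs_le h
      linarith
    rw [bellman_neg] at h1
    refine h1.trans ?_
    have hy0 : 0 ≤ y₂ := (sq_nonneg _).trans hy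
    refine mul_le_mul (Real.exp_le_exp.2 (by linarith)) ?_ (by linarith) (Real.exp_pos _).le
    nlinarith [mul_nonneg hU0 (neg_nonneg.2 h0), sq_nonneg U]

lemma bellman_concave {s α β x₁ x₂ y₁ y₂ z₁ z₂ : ℝ} (hs : 0 ≤ s) (hα : 0 ≤ α) (hβ : 0 ≤ β)
    (hαβ : α + β = 1) (e₁ : x₁ = α * y₁ + β * z₁) (e₂ : x₂ = α * y₂ + β * z₂)
    (hx : x₁ ^ 2 ≤ x₂) (hy : y₁ ^ 2 ≤ y₂) (hy' : y₂ ≤ y₁ ^ 2 + 1)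
    (hz : z₁ ^ 2 ≤ z₂) (hz' : z₂ ≤ z₁ ^ 2 + 1)
    (hxy : |x₁ - y₁| ≤ √(1 - (x₂ - x₁ ^ 2)) + √(1 - (y₂ - y₁ ^ 2)))
    (hxz : |x₁ - z₁| ≤ √(1 - (x₂ - x₁ ^ 2)) + √(1 - (z₂ - z₁ ^ 2))) :
    α * bellman s y₁ y₂ + β * bellman s z₁ z₂ ≤ bellman s x₁ x₂ := by
  wlog h0 : 0 ≤ x₁ generalizing x₁ y₁ z₁
  · have := this (x₁ := -x₁) (y₁ := -y₁) (z₁ := -z₁) (by rw [e₁]; ring) (by simpa) (by simpa)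
      (by simpa) (by simpa) (by simpa) ?_ ?_ (by linarith)
    · simpa only [bellman_neg] using this
    · rw [neg_sq, neg_sq, ← abs_neg]; convert hxy using 2; ring
    · rw [neg_sq, neg_sq, ← abs_neg]; convert hxz using 2; ring
  have h1 := mul_le_mul_of_nonneg_left (bellman_le_supporting hs h0 hx hy hy' hxy) hα
  have h2 := mul_le_mul_of_nonneg_left (bellman_le_supporting hs h0 hx hz hz' hxz) hβ
  refine (add_le_add h1 h2).trans (le_of_eq ?_)
  rw [bellman, abs_of_nonneg h0]
  set U := bellmanCut s x₁ x₂
  have : β = 1 - α := by linarith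
  rw [e₁, e₂, this]; ring

/-! ### Averages and oscillations under splitting, reflection and shifts. -/

lemma avg_eq_intervalIntegral (φ : ℝ → ℝ) {c d : ℝ} (h : c ≤ d) :
    avg φ c d = (d - c)⁻¹ * ∫ t in c..d, φ t := by
  rw [avg, setAverage_eq, intervalIntegral.integral_of_le h, integral_Ioc_eq_integral_Ioo,
    Real.volume_real_Ioo_of_le h, smul_eq_mul]

lemma avg_eq_setIntegral (φ : ℝ → ℝ) {c d : ℝ} (h : c ≤ d) :
    avg φ c d = (d - c)⁻¹ * ∫ t in Ioo c d, φ t := by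
  rw [avg, setAverage_eq, Real.volume_real_Ioo_of_le h, smul_eq_mul]

lemma avg_comp_neg (φ : ℝ → ℝ) {c d : ℝ} (h : c ≤ d) :
    avg (fun t => φ (-t)) c d = avg φ (-d) (-c) := by
  rw [avg_eq_intervalIntegral _ h, avg_eq_intervalIntegral _ (neg_le_neg h),
    intervalIntegral.integral_comp_neg]
  ring_nf

lemma osc2_comp_neg (φ : ℝ → ℝ) {c d : ℝ} (h : c ≤ d) :
    osc2 (fun t => φ (-t)) c d = osc2 φ (-d) (-c) := by
  rw [osc2, osc2, avg_comp_neg φ h, avg_comp_neg (fun t => φ t ^ 2) h]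

lemma avg_split {φ : ℝ → ℝ} {c m d : ℝ} (hφ : IntegrableOn φ (Ioo c d)) (h₁ : c < m)
    (h₂ : m < d) :
    avg φ c d = (m - c) / (d - c) * avg φ c m + (d - m) / (d - c) * avg φ m d := by
  have i₁ : IntervalIntegrable φ volume c m :=
    (intervalIntegrable_iff_integrableOn_Ioo_of_le h₁.le).2
      (hφ.mono_set (Ioo_subset_Ioo_right h₂.le))
  have i₂ : IntervalIntegrable φ volume m d :=
    (intervalIntegrable_iff_integrableOn_Ioo_of_le h₂.le).2
      (hφ.mono_set (Ioo_subset_Ioo_left h₁.le))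
  rw [avg_eq_intervalIntegral _ h₁.le, avg_eq_intervalIntegral _ h₂.le,
    avg_eq_intervalIntegral _ (h₁.trans h₂).le,
    ← intervalIntegral.integral_add_adjacent_intervals i₁ i₂]
  have := sub_pos.2 h₁
  have := sub_pos.2 h₂
  have := sub_pos.2 (h₁.trans h₂)
  field_simp

lemma avg_sub_const_sq {φ : ℝ → ℝ} {c d : ℝ} (h : c < d) (h₁ : IntegrableOn φ (Ioo c d))
    (h₂ : IntegrableOn (fun t => φ t ^ 2) (Ioo c d)) (k : ℝ) :
    avg (fun t => (φ t - k) ^ 2) c d = osc2 φ c d + (avg φ c d - k) ^ 2 := by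
  have e : ∫ t in Ioo c d, (φ t - k) ^ 2 =
      (∫ t in Ioo c d, φ t ^ 2) - 2 * k * (∫ t in Ioo c d, φ t) + k ^ 2 * (d - c) := by
    have : ∀ t, (φ t - k) ^ 2 = φ t ^ 2 - 2 * k * φ t + k ^ 2 := fun t => by ring
    simp_rw [this]
    have i₁ : IntegrableOn (fun t => 2 * k * φ t) (Ioo c d) := h₁.const_mul _
    have i₂ : IntegrableOn (fun t => φ t ^ 2 - 2 * k * φ t) (Ioo c d) := h₂.sub i₁
    have i₃ : IntegrableOn (fun _ : ℝ => k ^ 2) (Ioo c d) := by simp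
    rw [integral_add i₂ i₃, integral_sub h₂ i₁,
      integral_const_mul, setIntegral_const, Real.volume_real_Ioo_of_le h.le]
    simp [mul_comm]
  rw [osc2, avg_eq_setIntegral _ h.le, avg_eq_setIntegral _ h.le, avg_eq_setIntegral _ h.le, e]
  have := sub_pos.2 h
  field_simp
  ring

lemma avg_nonneg {φ : ℝ → ℝ} {c d : ℝ} (h : c ≤ d) (hφ : ∀ t, 0 ≤ φ t) : 0 ≤ avg φ c d := by
  rw [avg_eq_setIntegral _ h]
  exact mul_nonneg (inv_nonneg.2 (sub_nonneg.2 h)) (integral_nonneg hφ)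

lemma osc2_nonneg {φ : ℝ → ℝ} {c d : ℝ} (h : c < d) (h₁ : IntegrableOn φ (Ioo c d))
    (h₂ : IntegrableOn (fun t => φ t ^ 2) (Ioo c d)) : 0 ≤ osc2 φ c d := by
  have := avg_sub_const_sq h h₁ h₂ (avg φ c d)
  rw [sub_self, zero_pow two_ne_zero, add_zero] at this
  rw [← this]
  exact avg_nonneg h.le fun t => sq_nonneg _

lemma osc2_le_avg_sub_const_sq {φ : ℝ → ℝ} {c d : ℝ} (h : c < d)
    (h₁ : IntegrableOn φ (Ioo c d)) (h₂ : IntegrableOn (fun t => φ t ^ 2) (Ioo c d)) (k : ℝ) :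
    osc2 φ c d ≤ avg (fun t => (φ t - k) ^ 2) c d := by
  rw [avg_sub_const_sq h h₁ h₂]
  linarith [sq_nonneg (avg φ c d - k)]

/-! ### Cutting an interval so that the Bellman segment stays in the strip. -/

/-- `φ` and `φ²` are integrable on `(a, b)` and the `2`-oscillations over all subintervals are at
most `κ`. -/
structure OscBoundedBy (κ : ℝ) (φ : ℝ → ℝ) (a b : ℝ) : Prop where
  integrable : IntegrableOn φ (Ioo a b)
  integrable_sq : IntegrableOn (fun t => φ t ^ 2) (Ioo a b)
  osc2_le : ∀ c d : ℝ, a ≤ c → c < d → d ≤ b → osc2 φ c d ≤ κ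

namespace OscBoundedBy

variable {κ : ℝ} {φ : ℝ → ℝ} {a b : ℝ}

lemma mono (h : OscBoundedBy κ φ a b) {c d : ℝ} (hc : a ≤ c) (hd : d ≤ b) :
    OscBoundedBy κ φ c d where
  integrable := h.integrable.mono_set (Ioo_subset_Ioo hc hd)
  integrable_sq := h.integrable_sq.mono_set (Ioo_subset_Ioo hc hd)
  osc2_le c' d' h₁ h₂ h₃ := h.osc2_le c' d' (hc.trans h₁) h₂ (h₃.trans hd)

lemma comp_neg (h : OscBoundedBy κ φ a b) : OscBoundedBy κ (fun t => φ (-t)) (-b) (-a) where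
  integrable := by
    have := h.integrable.comp_neg
    simpa using this
  integrable_sq := by
    have := h.integrable_sq.comp_neg
    simpa using this
  osc2_le c d h₁ h₂ h₃ := by
    rw [osc2_comp_neg _ h₂.le]
    exact h.osc2_le _ _ (by linarith) (by linarith) (by linarith)

lemma nonneg (h : OscBoundedBy κ φ a b) {c d : ℝ} (hc : a ≤ c) (hcd : c < d) (hd : d ≤ b) :
    0 ≤ osc2 φ c d :=
  osc2_nonneg hcd (h.mono hc hd).integrable (h.mono hc hd).integrable_sq

/-- An interval may be cut at a point that is uniformly far from its ends, so that the segment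
between the two new Bellman points stays in the strip. -/
structure IsGoodCut (κ : ℝ) (φ : ℝ → ℝ) (c d m : ℝ) : Prop where
  lt_left : c < m
  lt_right : m < d
  left_le : m - c ≤ max (1 / 2) (2 * κ - 1) * (d - c)
  right_le : d - m ≤ max (1 / 2) (2 * κ - 1) * (d - c)
  left : |avg φ c d - avg φ c m| ≤ √(1 - osc2 φ c d) + √(1 - osc2 φ c m)
  right : |avg φ c d - avg φ m d| ≤ √(1 - osc2 φ c d) + √(1 - osc2 φ m d)

lemma osc2_split (h : OscBoundedBy κ φ a b) {m : ℝ} (h₁ : a < m) (h₂ : m < b) :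
    osc2 φ a b = (m - a) / (b - a) * osc2 φ a m + (b - m) / (b - a) * osc2 φ m b +
      (m - a) / (b - a) * ((b - m) / (b - a)) * (avg φ m b - avg φ a m) ^ 2 := by
  have e : (b - m) / (b - a) = 1 - (m - a) / (b - a) := by
    have := sub_pos.2 (h₁.trans h₂)
    field_simp; ring
  rw [osc2, osc2, osc2, avg_split h.integrable h₁ h₂, avg_split h.integrable_sq h₁ h₂, e]
  ring

lemma continuousOn_avg {c d : ℝ} (hcd : c ≤ d) {f : ℝ → ℝ} (hf : IntegrableOn f (Ioo a d))
    (hc : a < c) : ContinuousOn (fun m => avg f a m) (Icc c d) := by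
  have h1 : ContinuousOn (fun m => ∫ t in a..m, f t) (Icc c d) := by
    have := intervalIntegral.continuousOn_primitive_interval (μ := volume) (f := f)
      (a := a) (b := d) (by
        rw [uIcc_of_le (hc.le.trans hcd)]
        exact (integrableOn_Icc_iff_integrableOn_Ioo).2 hf)
    rw [uIcc_of_le (hc.le.trans hcd)] at this
    exact this.mono (Icc_subset_Icc_left hc.le)
  have h2 : ContinuousOn (fun m : ℝ => (m - a)⁻¹ * ∫ t in a..m, f t) (Icc c d) := by
    refine ContinuousOn.mul (ContinuousOn.inv₀ (by fun_prop) ?_) h1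
    intro m hm
    have := hm.1
    linarith
  refine h2.congr fun m hm => ?_
  exact avg_eq_intervalIntegral f (hc.le.trans hm.1)

/-- Hypothesis `h` is tangency. The upper parabola minus the line through the three Bellman points
is a monic quadratic with values `R²`, `R₁²`, `R₂²` there; `R + R₁ = β * D` makes it a perfect
square vanishing between the first two points, so `R₂ = R + α * D` beyond. The lower bound on `β`
keeps the cut away from the end of the interval. -/
lemma split_estimates {κ α β D R R₁ R₂ V V₁ V₂ : ℝ} (hκ : κ < 1) (hαβ : α + β = 1)
    (hα : 1 / 2 ≤ α) (hβ : 0 < β) (hD : 0 ≤ D) (hR : 0 ≤ R) (hR₁ : 0 ≤ R₁) (hR₂ : 0 ≤ R₂)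
    (r : R ^ 2 = 1 - V) (r₁ : R₁ ^ 2 = 1 - V₁) (r₂ : R₂ ^ 2 = 1 - V₂) (v : V ≤ κ) (v₁ : V₁ ≤ κ)
    (w₁ : 0 ≤ V₁) (w₂ : 0 ≤ V₂)
    (e : V = α * V₁ + β * V₂ + α * β * D ^ 2) (h : R + R₁ = β * D) :
    2 * (1 - κ) ≤ β ∧ α * D ≤ R + R₂ := by
  obtain rfl : α = 1 - β := by linarith
  have e' : β * R₂ ^ 2 = β * (R + (1 - β) * D) ^ 2 := by
    obtain rfl : R₁ = β * D - R := by linarith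
    obtain rfl : V₁ = 1 - (β * D - R) ^ 2 := by linarith
    obtain rfl : V₂ = 1 - R₂ ^ 2 := by linarith
    obtain rfl : V = 1 - R ^ 2 := by linarith
    linear_combination e
  have hA : 0 ≤ (1 - β) * D := mul_nonneg (by linarith) hD
  have e₂ : R₂ = R + (1 - β) * D :=
    (pow_left_inj₀ hR₂ (add_nonneg hR hA) two_ne_zero).1 (mul_left_cancel₀ hβ.ne' e')
  refine ⟨?_, by linarith⟩
  -- Tangency gives `β * D ≥ 2 * √(1 - κ)`, while `α * β * D² ≤ V ≤ 1`. Eliminating `D` leaves `4 *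
  -- (1 - κ) * α ≤ β`, and `α ≥ 1 / 2`.
  have t₀ : √(1 - κ) ≤ R := Real.sqrt_le_iff.2 ⟨hR, by linarith⟩
  have t₁ : √(1 - κ) ≤ R₁ := Real.sqrt_le_iff.2 ⟨hR₁, by linarith⟩
  have t₂ : 4 * (1 - κ) ≤ (β * D) ^ 2 := by
    have := pow_le_pow_left₀ (by positivity) (add_le_add t₀ t₁) 2
    rw [h, ← two_mul, mul_pow, Real.sq_sqrt (by linarith)] at this
    linarith
  have t₃ : (1 - β) * β * D ^ 2 ≤ 1 := by
    have := mul_nonneg (by linarith : 0 ≤ 1 - β) w₁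
    have := mul_nonneg hβ.le w₂
    linarith
  have t₄ : (1 - β) * (β * D) ^ 2 ≤ β := by nlinarith
  nlinarith

/-- When the midpoint fails on the left, the cut is moved to the right. As it reaches `b` the left
Bellman point becomes that of the whole interval and the condition holds strictly, so by continuity
it is an equality somewhere between; there `split_estimates` settles the other side. -/
lemma exists_isGoodCut_of_left (hκ : κ < 1) (h : OscBoundedBy κ φ a b) (hab : a < b)
    (hl : √(1 - osc2 φ a b) + √(1 - osc2 φ a ((a + b) / 2)) <
      |avg φ a b - avg φ a ((a + b) / 2)|) : ∃ m, IsGoodCut κ φ a b m := by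
  set k : ℝ → ℝ := fun m => √(1 - osc2 φ a b) + √(1 - osc2 φ a m) - |avg φ a b - avg φ a m|
    with hk
  have hm : a < (a + b) / 2 := by linarith
  have hmb : (a + b) / 2 ≤ b := by linarith
  have c1 := continuousOn_avg hmb h.integrable hm
  have c2 := continuousOn_avg hmb h.integrable_sq hm
  have c3 : ContinuousOn k (Icc ((a + b) / 2) b) := by
    refine ContinuousOn.sub (ContinuousOn.add continuousOn_const ?_) ?_
    · exact (continuousOn_const.sub (c2.sub (c1.pow 2))).sqrt
    · exact (continuousOn_const.sub c1).abs
  have hpos : 0 < √(1 - osc2 φ a b) :=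
    Real.sqrt_pos.2 (by linarith [h.osc2_le a b le_rfl hab le_rfl])
  obtain ⟨m, ⟨hm1, hm2⟩, hm0⟩ : (0 : ℝ) ∈ k '' Icc ((a + b) / 2) b := by
    refine intermediate_value_Icc hmb c3 ⟨?_, ?_⟩
    · simp only [hk]; linarith
    · simp only [hk, sub_self, abs_zero]; linarith
  have hmb' : m < b := by
    refine lt_of_le_of_ne hm2 ?_
    rintro rfl
    simp only [hk, sub_self, abs_zero] at hm0
    linarith
  have ham : a < m := hm.trans_le hm1
  have hL := sub_pos.2 hab
  set α := (m - a) / (b - a) with hα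
  set β := (b - m) / (b - a) with hβ
  have hαβ : β = 1 - α := by rw [hα, hβ]; field_simp; ring
  have hα0 : 1 / 2 ≤ α := by rw [hα, le_div_iff₀ hL]; linarith
  have hβ0 : 0 < β := div_pos (by linarith) hL
  have e1 := avg_split h.integrable ham hmb'
  have e2 := h.osc2_split ham hmb'
  rw [← hα, ← hβ] at e1 e2
  have v0 := h.osc2_le a b le_rfl hab le_rfl
  have v1 := h.osc2_le a m le_rfl ham hmb'.le
  have v2 := h.osc2_le m b ham.le hmb' le_rfl
  have w1 := h.nonneg le_rfl ham hmb'.le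
  have w2 := h.nonneg ham.le hmb' le_rfl
  have r0 := Real.sq_sqrt (show 0 ≤ 1 - osc2 φ a b by linarith)
  have r1 := Real.sq_sqrt (show 0 ≤ 1 - osc2 φ a m by linarith)
  have r2 := Real.sq_sqrt (show 0 ≤ 1 - osc2 φ m b by linarith)
  have p1 : 0 ≤ √(1 - osc2 φ a m) := Real.sqrt_nonneg _
  have p2 : 0 ≤ √(1 - osc2 φ m b) := Real.sqrt_nonneg _
  have hm0 : √(1 - osc2 φ a b) + √(1 - osc2 φ a m) = |avg φ a b - avg φ a m| := by
    simp only [hk] at hm0; linarith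
  set D := |avg φ m b - avg φ a m| with hD
  have hD2 : (avg φ m b - avg φ a m) ^ 2 = D ^ 2 := (sq_abs _).symm
  have hD0 : 0 ≤ D := abs_nonneg _
  have a1 : |avg φ a b - avg φ a m| = β * D := by
    have : avg φ a b - avg φ a m = β * (avg φ m b - avg φ a m) := by rw [e1, hαβ]; ring
    rw [this, abs_mul, abs_of_pos hβ0]
  have a2 : |avg φ a b - avg φ m b| = α * D := by
    have : avg φ a b - avg φ m b = -(α * (avg φ m b - avg φ a m)) := by rw [e1, hαβ]; ring
    rw [this, abs_neg, abs_mul, abs_of_nonneg (by linarith : 0 ≤ α)]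
  rw [hD2] at e2
  rw [a1] at hm0
  obtain ⟨hlow, hright⟩ := split_estimates hκ (by linarith) hα0 hβ0 hD0 hpos.le p1 p2 r0 r1 r2
    v0 v1 w1 w2 e2 hm0
  refine ⟨m, ham, hmb', ?_, ?_, ?_, ?_⟩
  · refine le_trans ?_ (mul_le_mul_of_nonneg_right (le_max_right _ _) hL.le)
    have : m - a = α * (b - a) := by rw [hα]; field_simp
    rw [this]
    exact mul_le_mul_of_nonneg_right (by linarith) hL.le
  · refine le_trans ?_ (mul_le_mul_of_nonneg_right (le_max_left _ _) hL.le)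
    linarith
  · rw [a1, hm0]
  · rw [a2]; exact hright

lemma exists_isGoodCut (hκ : κ < 1) (h : OscBoundedBy κ φ a b) (hab : a < b) :
    ∃ m, IsGoodCut κ φ a b m := by
  by_cases hl : √(1 - osc2 φ a b) + √(1 - osc2 φ a ((a + b) / 2)) <
      |avg φ a b - avg φ a ((a + b) / 2)|
  · exact h.exists_isGoodCut_of_left hκ hab hl
  by_cases hr : √(1 - osc2 φ a b) + √(1 - osc2 φ ((a + b) / 2) b) <
      |avg φ a b - avg φ ((a + b) / 2) b|
  · have hmid : -b ≤ (-b + -a) / 2 := by linarith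
    have hneg : -((-b + -a) / 2) = (a + b) / 2 := by ring
    -- Failure on the right becomes failure on the left for the reflected function.
    obtain ⟨m, hm⟩ := h.comp_neg.exists_isGoodCut_of_left hκ (neg_lt_neg hab) (by
      rwa [osc2_comp_neg _ (by linarith), osc2_comp_neg _ hmid, avg_comp_neg _ (by linarith),
        avg_comp_neg _ hmid, neg_neg, neg_neg, hneg])
    have h1 := hm.lt_left
    have h2 := hm.lt_right
    refine ⟨-m, by linarith, by linarith, ?_, ?_, ?_, ?_⟩
    · have := hm.right_le
      ring_nf at this ⊢
      exact this
    · have := hm.left_le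
      ring_nf at this ⊢
      exact this
    · have := hm.right
      rwa [osc2_comp_neg _ (by linarith), osc2_comp_neg _ (by linarith),
        avg_comp_neg _ (by linarith), avg_comp_neg _ (by linarith), neg_neg, neg_neg] at this
    · have := hm.left
      rwa [osc2_comp_neg _ (by linarith), osc2_comp_neg _ (by linarith),
        avg_comp_neg _ (by linarith), avg_comp_neg _ (by linarith), neg_neg, neg_neg] at this
  have hle := mul_le_mul_of_nonneg_right (le_max_left (1 / 2) (2 * κ - 1)) (sub_pos.2 hab).le
  exact ⟨(a + b) / 2, by linarith, by linarith, by linarith, by linarith,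
    not_lt.1 hl, not_lt.1 hr⟩

end OscBoundedBy

/-! ### Bellman induction along iterated good cuts. -/

namespace OscBoundedBy

variable {κ : ℝ} {φ : ℝ → ℝ} {a b : ℝ}

/-- `g` is the step function taking on each interval of the `n`th generation the value of `bellman`
at its Bellman point; by concavity its integral does not exceed the value before cutting. Half-open
intervals make the pieces a true partition. -/
lemma exists_bellman_step (hκ : κ < 1) {s : ℝ} (hs : 0 ≤ s) (n : ℕ) :
    ∀ a b : ℝ, a < b → OscBoundedBy κ φ a b → ∃ g : ℝ → ℝ, Measurable g ∧
      (∫⁻ t in Ico a b, ENNReal.ofReal (g t)) ≤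
        ENNReal.ofReal ((b - a) * bellman s (avg φ a b) (avg (fun t => φ t ^ 2) a b)) ∧
      ∀ t ∈ Ico a b, ∃ c d, a ≤ c ∧ c < d ∧ d ≤ b ∧ t ∈ Icc c d ∧
        d - c ≤ max (1 / 2) (2 * κ - 1) ^ n * (b - a) ∧
        g t = bellman s (avg φ c d) (avg (fun t => φ t ^ 2) c d) := by
  induction n with
  | zero =>
    intro a b hab h
    refine ⟨fun _ => bellman s (avg φ a b) (avg (fun t => φ t ^ 2) a b), measurable_const, ?_, ?_⟩
    · rw [lintegral_const, Measure.restrict_apply_univ, Real.volume_Ico,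
        ENNReal.ofReal_mul (sub_pos.2 hab).le, mul_comm]
    · intro t ht
      exact ⟨a, b, le_rfl, hab, le_rfl, Ico_subset_Icc_self ht, by simp, rfl⟩
  | succ n ih =>
    intro a b hab h
    obtain ⟨m, hm⟩ := h.exists_isGoodCut hκ hab
    obtain ⟨g₁, hg₁, hi₁, hp₁⟩ := ih a m hm.lt_left (h.mono le_rfl hm.lt_right.le)
    obtain ⟨g₂, hg₂, hi₂, hp₂⟩ := ih m b hm.lt_right (h.mono hm.lt_left.le le_rfl)
    have hL := sub_pos.2 hab
    have hq : 0 ≤ max (1 / 2) (2 * κ - 1) := le_max_of_le_left (by norm_num)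
    refine ⟨fun t => if t < m then g₁ t else g₂ t,
      Measurable.ite measurableSet_Iio hg₁ hg₂, ?_, ?_⟩
    · rw [← Ico_union_Ico_eq_Ico hm.lt_left.le hm.lt_right.le,
        lintegral_union measurableSet_Ico
          (Set.disjoint_left.2 fun t h1 h2 => absurd h1.2 (not_lt.2 h2.1))]
      have e₁ : ∫⁻ t in Ico a m, ENNReal.ofReal (if t < m then g₁ t else g₂ t) =
          ∫⁻ t in Ico a m, ENNReal.ofReal (g₁ t) :=
        setLIntegral_congr_fun measurableSet_Ico fun t ht => by simp [ht.2]
      have e₂ : ∫⁻ t in Ico m b, ENNReal.ofReal (if t < m then g₁ t else g₂ t) =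
          ∫⁻ t in Ico m b, ENNReal.ofReal (g₂ t) :=
        setLIntegral_congr_fun measurableSet_Ico fun t ht => by simp [not_lt.2 ht.1]
      rw [e₁, e₂]
      have k₁ := h.nonneg le_rfl hm.lt_left hm.lt_right.le
      have k₂ := h.nonneg hm.lt_left.le hm.lt_right le_rfl
      have k₀ := h.nonneg le_rfl hab le_rfl
      have v₁ := h.osc2_le _ _ le_rfl hm.lt_left hm.lt_right.le
      have v₂ := h.osc2_le _ _ hm.lt_left.le hm.lt_right le_rfl
      refine (add_le_add hi₁ hi₂).trans ?_
      have hB := bellman_concave hs (α := (m - a) / (b - a)) (β := (b - m) / (b - a))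
        (div_nonneg (sub_nonneg.2 hm.lt_left.le) hL.le)
        (div_nonneg (sub_nonneg.2 hm.lt_right.le) hL.le) (by field_simp; ring)
        (avg_split h.integrable hm.lt_left hm.lt_right)
        (avg_split h.integrable_sq hm.lt_left hm.lt_right)
        (sub_nonneg.1 k₀) (sub_nonneg.1 k₁) (by simp only [osc2] at v₁; linarith)
        (sub_nonneg.1 k₂) (by simp only [osc2] at v₂; linarith) hm.left hm.right
      rw [← ENNReal.ofReal_add
        (mul_nonneg (sub_nonneg.2 hm.lt_left.le) (bellman_nonneg s (sub_nonneg.1 k₁)))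
        (mul_nonneg (sub_nonneg.2 hm.lt_right.le) (bellman_nonneg s (sub_nonneg.1 k₂)))]
      apply ENNReal.ofReal_le_ofReal
      refine le_trans (le_of_eq ?_) (mul_le_mul_of_nonneg_left hB hL.le)
      field_simp
    · intro t ht
      by_cases htm : t < m
      · obtain ⟨c, d, h₁, h₂, h₃, h₄, h₅, h₆⟩ := hp₁ t ⟨ht.1, htm⟩
        refine ⟨c, d, h₁, h₂, h₃.trans hm.lt_right.le, h₄, h₅.trans ?_, by simp [htm, h₆]⟩
        rw [pow_succ, mul_assoc]
        exact mul_le_mul_of_nonneg_left hm.left_le (pow_nonneg hq _)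
      · obtain ⟨c, d, h₁, h₂, h₃, h₄, h₅, h₆⟩ := hp₂ t ⟨not_lt.1 htm, ht.2⟩
        refine ⟨c, d, hm.lt_left.le.trans h₁, h₂, h₃, h₄, h₅.trans ?_, by simp [htm, h₆]⟩
        rw [pow_succ, mul_assoc]
        exact mul_le_mul_of_nonneg_left hm.right_le (pow_nonneg hq _)

end OscBoundedBy

/-! ### Passage to the limit, scaling, and exponential decay. -/

lemma ae_tendsto_avg {f : ℝ → ℝ} {a b : ℝ} (hf : IntegrableOn f (Ioo a b)) :
    ∀ᵐ t, t ∈ Ioo a b → ∀ c d : ℕ → ℝ, (∀ n, a ≤ c n ∧ c n < d n ∧ d n ≤ b) →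
      (∀ n, t ∈ Icc (c n) (d n)) → Tendsto (fun n => d n - c n) atTop (𝓝 0) →
      Tendsto (fun n => avg f (c n) (d n)) atTop (𝓝 (f t)) := by
  have hi : LocallyIntegrable ((Ioo a b).indicator f) volume :=
    ((integrable_indicator_iff measurableSet_Ioo).2 hf).locallyIntegrable
  filter_upwards [IsUnifLocDoublingMeasure.ae_tendsto_average volume hi 1] with t ht htab c d hcd hmem hlim
  have hδ : Tendsto (fun n => (d n - c n) / 2) atTop (𝓝[>] 0) := by
    rw [tendsto_nhdsWithin_iff]
    refine ⟨by simpa using hlim.div_const 2, .of_forall fun n => ?_⟩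
    have := (hcd n).2.1
    simp only [mem_Ioi]
    linarith
  have hball : ∀ n, Metric.closedBall ((c n + d n) / 2) ((d n - c n) / 2) = Icc (c n) (d n) := by
    intro n
    rw [Real.closedBall_eq_Icc]
    congr 1 <;> ring
  have := ht (fun n => (c n + d n) / 2) (fun n => (d n - c n) / 2) hδ (.of_forall fun n => by
    rw [one_mul, hball]; exact hmem n)
  rw [indicator_of_mem htab] at this
  refine this.congr fun n => ?_
  rw [hball, avg, setAverage_congr Ioo_ae_eq_Icc.symm]
  refine setAverage_congr_fun measurableSet_Ioo (.of_forall fun x hx => ?_)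
  exact indicator_of_mem (Ioo_subset_Ioo (hcd n).1 (hcd n).2.2 hx) _

lemma tendsto_bellman (s : ℝ) {u v : ℕ → ℝ} {x y : ℝ} (hu : Tendsto u atTop (𝓝 x))
    (hv : Tendsto v atTop (𝓝 y)) :
    Tendsto (fun n => bellman s (u n) (v n)) atTop (𝓝 (bellman s x y)) := by
  have h := ((continuous_bellman s).tendsto (x, y)).comp (hu.prodMk_nhds hv)
  exact h

/-- Because `κ < 1`, the lengths of the cut intervals shrink geometrically, so the step functions
converge a.e. to `bellman s (φ t) (φ t ^ 2)`, which is the boundary value. Fatou's lemma suffices,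
with no domination. -/
lemma OscBoundedBy.lintegral_truncation_le {κ : ℝ} {φ : ℝ → ℝ} {a b s : ℝ}
    (h : OscBoundedBy κ φ a b) (hκ : κ < 1) (hab : a < b) (hs : 0 ≤ s) :
    ∫⁻ t in Ioo a b, ENNReal.ofReal (max (|φ t| - s) 0 ^ 2) ≤
      ENNReal.ofReal ((b - a) * bellman s (avg φ a b) (avg (fun t => φ t ^ 2) a b)) := by
  choose g hg hi hp using fun n => h.exists_bellman_step hκ hs n a b hab
  have hq0 : 0 ≤ max (1 / 2) (2 * κ - 1) := le_max_of_le_left (by norm_num)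
  have hq1 : max (1 / 2) (2 * κ - 1) < 1 := max_lt (by norm_num) (by linarith)
  have hlim : ∀ᵐ t, t ∈ Ioo a b → Tendsto (fun n => ENNReal.ofReal (g n t)) atTop
      (𝓝 (ENNReal.ofReal (max (|φ t| - s) 0 ^ 2))) := by
    filter_upwards [ae_tendsto_avg h.integrable, ae_tendsto_avg h.integrable_sq] with t h₁ h₂ ht
    choose c d hc hcd hd hmem hlen hval using fun n => hp n t (Ioo_subset_Ico_self ht)
    have hto : Tendsto (fun n => d n - c n) atTop (𝓝 0) := by
      refine squeeze_zero (fun n => (sub_pos.2 (hcd n)).le) hlen ?_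
      simpa using (tendsto_pow_atTop_nhds_zero_of_lt_one hq0 hq1).mul_const (b - a)
    have t₁ := h₁ ht c d (fun n => ⟨hc n, hcd n, hd n⟩) hmem hto
    have t₂ := h₂ ht c d (fun n => ⟨hc n, hcd n, hd n⟩) hmem hto
    rw [← bellman_boundary hs]
    have t₃ := tendsto_bellman s t₁ t₂
    exact ENNReal.tendsto_ofReal (t₃.congr fun n => (hval n).symm)
  calc ∫⁻ t in Ioo a b, ENNReal.ofReal (max (|φ t| - s) 0 ^ 2)
      = ∫⁻ t in Ioo a b, liminf (fun n => ENNReal.ofReal (g n t)) atTop := by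
        refine setLIntegral_congr_fun_ae measurableSet_Ioo ?_
        filter_upwards [hlim] with t ht hmem
        exact (ht hmem).liminf_eq.symm
    _ ≤ liminf (fun n => ∫⁻ t in Ioo a b, ENNReal.ofReal (g n t)) atTop :=
        lintegral_liminf_le fun n => (hg n).ennreal_ofReal
    _ ≤ _ := by
        refine liminf_le_of_le (by isBoundedDefault) fun x hx => ?_
        obtain ⟨n, hn⟩ := hx.exists
        exact hn.trans ((lintegral_mono_set Ioo_subset_Ico_self).trans (hi n))

lemma avg_const_mul (k : ℝ) (φ : ℝ → ℝ) {c d : ℝ} (h : c ≤ d) :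
    avg (fun t => k * φ t) c d = k * avg φ c d := by
  rw [avg_eq_setIntegral _ h, avg_eq_setIntegral _ h, integral_const_mul]; ring

lemma avg_sub_const {φ : ℝ → ℝ} {c d : ℝ} (h : c < d) (h₁ : IntegrableOn φ (Ioo c d)) (k : ℝ) :
    avg (fun t => φ t - k) c d = avg φ c d - k := by
  have i : IntegrableOn (fun _ : ℝ => k) (Ioo c d) := by simp
  rw [avg_eq_setIntegral _ h.le, avg_eq_setIntegral _ h.le, integral_sub h₁ i, setIntegral_const,
    Real.volume_real_Ioo_of_le h.le]
  have := sub_pos.2 h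
  simp only [smul_eq_mul]
  field_simp

lemma osc2_mul_sub {φ : ℝ → ℝ} {c d : ℝ} (h : c < d) (h₁ : IntegrableOn φ (Ioo c d))
    (h₂ : IntegrableOn (fun t => φ t ^ 2) (Ioo c d)) (k m : ℝ) :
    osc2 (fun t => k * (φ t - m)) c d = k ^ 2 * osc2 φ c d := by
  have : (fun t => (k * (φ t - m)) ^ 2) = fun t => k ^ 2 * (φ t - m) ^ 2 := by
    funext t; ring
  rw [osc2, this, avg_const_mul _ _ h.le, avg_const_mul _ (fun t => φ t - m) h.le,
    avg_sub_const_sq h h₁ h₂, avg_sub_const h h₁]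
  ring

lemma OscBoundedBy.const_mul_sub {κ : ℝ} {φ : ℝ → ℝ} {a b : ℝ} (h : OscBoundedBy κ φ a b)
    (k m : ℝ) : OscBoundedBy (k ^ 2 * κ) (fun t => k * (φ t - m)) a b where
  integrable := (h.integrable.sub (by simp)).const_mul _
  integrable_sq := by
    have i₂ : IntegrableOn (fun t => φ t ^ 2 - 2 * m * φ t + m ^ 2) (Ioo a b) :=
      (h.integrable_sq.sub (h.integrable.const_mul _)).add (by simp)
    refine (i₂.const_mul (k ^ 2)).congr (.of_forall fun t => ?_)
    ring
  osc2_le c d h₁ h₂ h₃ := by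
    have := h.mono h₁ h₃
    rw [osc2_mul_sub h₂ this.integrable this.integrable_sq]
    exact mul_le_mul_of_nonneg_left (h.osc2_le c d h₁ h₂ h₃) (sq_nonneg _)

/-- The exponential decay of the quadratic truncations of a function of bounded mean
oscillation. -/
lemma OscBoundedBy.lintegral_truncation_sub_avg_le {N : ℝ} {φ : ℝ → ℝ} {a b s : ℝ}
    (h : OscBoundedBy (N ^ 2) φ a b) (hN : 0 < N) (hab : a < b) (hs : 0 ≤ s) :
    ∫⁻ t in Ioo a b, ENNReal.ofReal (max (|φ t - avg φ a b| - s) 0 ^ 2) ≤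
      ENNReal.ofReal (Real.exp (-s / N) * ((b - a) * osc2 φ a b)) := by
  -- Dividing by `δ > N` makes the oscillation bound strictly less than `1`; centring puts the
  -- Bellman point on the axis `x = 0`, where `bellman` is explicit. Finally `δ` decreases to `N`.
  have key : ∀ δ > N, ∫⁻ t in Ioo a b, ENNReal.ofReal (max (|φ t - avg φ a b| - s) 0 ^ 2) ≤
      ENNReal.ofReal (Real.exp (-s / δ) * ((b - a) * osc2 φ a b)) := by
    intro δ hδ
    have hδ0 : 0 < δ := hN.trans hδ
    have hk : δ⁻¹ ^ 2 * N ^ 2 < 1 := by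
      rw [← mul_pow, inv_mul_eq_div, sq_lt_one_iff₀ (by positivity), div_lt_one hδ0]
      exact hδ
    have h₁ := (h.const_mul_sub δ⁻¹ (avg φ a b)).lintegral_truncation_le hk hab
      (div_nonneg hs hδ0.le)
    have e₁ : avg (fun t => δ⁻¹ * (φ t - avg φ a b)) a b = 0 := by
      rw [avg_const_mul _ (fun t => φ t - avg φ a b) hab.le, avg_sub_const hab h.integrable,
        sub_self, mul_zero]
    have e₂ : avg (fun t => (δ⁻¹ * (φ t - avg φ a b)) ^ 2) a b = δ⁻¹ ^ 2 * osc2 φ a b := by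
      have := osc2_mul_sub hab h.integrable h.integrable_sq δ⁻¹ (avg φ a b)
      rw [osc2, e₁] at this
      linarith
    have h0 := h.nonneg le_rfl hab le_rfl
    rw [e₁, e₂, bellman_zero_left (by positivity)] at h₁
    have e₃ : ∀ t, ENNReal.ofReal (max (|φ t - avg φ a b| - s) 0 ^ 2) =
        ENNReal.ofReal (δ ^ 2) *
          ENNReal.ofReal (max (|δ⁻¹ * (φ t - avg φ a b)| - s / δ) 0 ^ 2) := by
      intro t
      rw [← ENNReal.ofReal_mul (sq_nonneg _), ← mul_pow, mul_max_of_nonneg _ _ hδ0.le, abs_mul,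
        abs_of_pos (inv_pos.2 hδ0)]
      congr 3
      · field_simp
      · simp
    simp_rw [e₃]
    rw [lintegral_const_mul' _ _ ENNReal.ofReal_ne_top]
    refine (mul_le_mul_right h₁ _).trans (le_of_eq ?_)
    rw [← ENNReal.ofReal_mul (sq_nonneg _)]
    congr 1
    rw [neg_div]
    field_simp
  refine ge_of_tendsto (x := 𝓝[>] N) ?_ (eventually_mem_nhdsWithin.mono key)
  refine (ENNReal.continuous_ofReal.tendsto _).comp ?_
  refine Tendsto.mul_const _ ?_
  refine (Real.continuous_exp.tendsto _).comp ?_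
  exact (ContinuousAt.div continuousAt_const continuousAt_id hN.ne').tendsto.mono_left
    nhdsWithin_le_nhds

lemma MemBMO.osc2_le_bmoNorm_sq {φ : ℝ → ℝ} {a b : ℝ} (h : MemBMO φ a b) {c d : ℝ}
    (hc : a ≤ c) (hcd : c < d) (hd : d ≤ b) : osc2 φ c d ≤ bmoNorm φ a b ^ 2 := by
  obtain ⟨C, hC⟩ := h.2
  have hb : BddAbove {r : ℝ | ∃ c d : ℝ, a ≤ c ∧ c < d ∧ d ≤ b ∧ r = √(osc2 φ c d)} := by
    refine ⟨|C|, ?_⟩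
    rintro r ⟨c, d, h₁, h₂, h₃, rfl⟩
    rw [← Real.sqrt_sq_eq_abs]
    exact Real.sqrt_le_sqrt (hC c d h₁ h₂ h₃).2
  have h₁ : √(osc2 φ c d) ≤ bmoNorm φ a b := le_csSup hb ⟨c, d, hc, hcd, hd, rfl⟩
  have h₂ : 0 ≤ osc2 φ c d :=
    osc2_nonneg hcd (h.1.mono_set (Ioo_subset_Ioo hc hd)) (hC c d hc hcd hd).1
  rw [← Real.sq_sqrt h₂]
  exact pow_le_pow_left₀ (Real.sqrt_nonneg _) h₁ 2

lemma MemBMO.oscBoundedBy {φ : ℝ → ℝ} {a b : ℝ} (h : MemBMO φ a b) (hab : a < b) :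
    OscBoundedBy (bmoNorm φ a b ^ 2) φ a b where
  integrable := h.1
  integrable_sq := by
    obtain ⟨C, hC⟩ := h.2
    exact (hC a b le_rfl hab le_rfl).1
  osc2_le _ _ h₁ h₂ h₃ := h.osc2_le_bmoNorm_sq h₁ h₂ h₃

lemma bmoNorm_nonneg (φ : ℝ → ℝ) (a b : ℝ) : 0 ≤ bmoNorm φ a b := by
  refine Real.sSup_nonneg ?_
  rintro r ⟨c, d, -, -, -, rfl⟩
  exact Real.sqrt_nonneg _

/-! ### Powers as mixtures of quadratic truncations, and the matching Gamma integrals. -/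

lemma lintegral_ofReal_eq_of_integral {α : Type*} [MeasurableSpace α] {μ : Measure α} {f : α → ℝ}
    {I : ℝ} (hi : Integrable f μ) (h0 : 0 ≤ᵐ[μ] f) (h : ∫ x, f x ∂μ = I) :
    ∫⁻ x, ENNReal.ofReal (f x) ∂μ = ENNReal.ofReal I := by
  rw [← h, ofReal_integral_eq_lintegral_ofReal hi h0]

lemma integrableOn_Ioc_rpow {q : ℝ} (hq : -1 < q) (t : ℝ) :
    IntegrableOn (fun s : ℝ => s ^ q) (Ioc 0 t) := by
  rcases le_total 0 t with h | h
  · exact (intervalIntegrable_iff_integrableOn_Ioc_of_le h).1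
      (intervalIntegral.intervalIntegrable_rpow' hq)
  · simp [Ioc_eq_empty_of_le h]

lemma integral_Ioc_rpow {q t : ℝ} (hq : -1 < q) (ht : 0 ≤ t) :
    ∫ s in Ioc 0 t, s ^ q = t ^ (q + 1) / (q + 1) := by
  rw [← intervalIntegral.integral_of_le ht, integral_rpow (Or.inl hq),
    Real.zero_rpow (by linarith), sub_zero]

/-- This is Taylor's formula at `0` with integral remainder of third order: the weight is half the
third derivative of `s ^ p`. -/
lemma lintegral_truncation_rpow {p t : ℝ} (hp : 2 < p) (ht : 0 ≤ t) :
    ∫⁻ s in Ioi (0 : ℝ), ENNReal.ofReal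
        (p * (p - 1) * (p - 2) / 2 * s ^ (p - 3) * max (t - s) 0 ^ 2) =
      ENNReal.ofReal (t ^ p) := by
  have hc : 0 ≤ p * (p - 1) * (p - 2) / 2 := by
    have := mul_nonneg (mul_nonneg (by linarith : 0 ≤ p) (by linarith : 0 ≤ p - 1))
      (by linarith : 0 ≤ p - 2)
    linarith
  rw [← Ioc_union_Ioi_eq_Ioi ht, lintegral_union measurableSet_Ioi (Ioc_disjoint_Ioi le_rfl)]
  have e₂ : ∫⁻ s in Ioi t, ENNReal.ofReal
      (p * (p - 1) * (p - 2) / 2 * s ^ (p - 3) * max (t - s) 0 ^ 2) = 0 := by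
    rw [setLIntegral_congr_fun (g := fun _ => 0) measurableSet_Ioi, lintegral_zero]
    intro s hs
    have : t - s ≤ 0 := by simp only [mem_Ioi] at hs; linarith
    simp [max_eq_right this]
  have e₁ : ∀ s ∈ Ioc 0 t, p * (p - 1) * (p - 2) / 2 * s ^ (p - 3) * max (t - s) 0 ^ 2 =
      p * (p - 1) * (p - 2) / 2 *
        (t ^ 2 * s ^ (p - 3) - 2 * t * s ^ (p - 2) + s ^ (p - 1)) := by
    intro s hs
    rw [max_eq_left (by linarith [hs.2]), show p - 2 = p - 3 + 1 by ring,
      show p - 1 = p - 3 + 2 by ring, Real.rpow_add hs.1, Real.rpow_add hs.1, Real.rpow_one,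
      Real.rpow_two]
    ring
  have i₁ := (integrableOn_Ioc_rpow (show -1 < p - 3 by linarith) t).const_mul (t ^ 2)
  have i₂ := (integrableOn_Ioc_rpow (show -1 < p - 2 by linarith) t).const_mul (2 * t)
  have i₃ := integrableOn_Ioc_rpow (show -1 < p - 1 by linarith) t
  have i₁₂ : IntegrableOn (fun s => t ^ 2 * s ^ (p - 3) - 2 * t * s ^ (p - 2)) (Ioc 0 t) :=
    i₁.sub i₂
  rw [e₂, add_zero]
  refine lintegral_ofReal_eq_of_integral ?_ ?_ ?_
  · exact ((i₁₂.add i₃).const_mul (p * (p - 1) * (p - 2) / 2)).congr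
      ((ae_restrict_iff' measurableSet_Ioc).2 (.of_forall fun s hs => (e₁ s hs).symm))
  · refine (ae_restrict_iff' measurableSet_Ioc).2 (.of_forall fun s hs => ?_)
    have := hs.1
    simp only [Pi.zero_apply]
    exact mul_nonneg (mul_nonneg hc (Real.rpow_nonneg hs.1.le _)) (sq_nonneg _)
  · rw [setIntegral_congr_fun measurableSet_Ioc e₁, integral_const_mul,
      integral_add i₁₂ i₃, integral_sub i₁ i₂, integral_const_mul, integral_const_mul,
      integral_Ioc_rpow (by linarith) ht, integral_Ioc_rpow (by linarith) ht,
      integral_Ioc_rpow (by linarith) ht]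
    rcases ht.eq_or_lt with rfl | ht
    · simp [Real.zero_rpow (by linarith : p ≠ 0)]
    · have h₁ : t ^ (p - 3 + 1) = t ^ p / t ^ 2 := by
        rw [← Real.rpow_two, ← Real.rpow_sub ht]; ring_nf
      have h₂ : t ^ (p - 2 + 1) = t ^ p / t := by
        nth_rw 3 [← Real.rpow_one t]
        rw [← Real.rpow_sub ht]; ring_nf
      rw [h₁, h₂, sub_add_cancel, show p - 3 + 1 = p - 2 by ring, show p - 2 + 1 = p - 1 by ring]
      have : p - 2 ≠ 0 := by linarith
      have : p - 1 ≠ 0 := by linarith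
      have : p ≠ 0 := by linarith
      field_simp
      ring

/-- For `p < 2` the weight `s ^ (p - 3)` is not integrable at `0`. Subtracting the truncation from
`t²` gains a factor of order `s` there and stays bounded at infinity, which gives convergence
exactly for `1 < p < 2`; the sign of the weight flips accordingly. -/
lemma lintegral_sq_sub_truncation_rpow {p t : ℝ} (hp : 1 < p) (hp' : p < 2) (ht : 0 ≤ t) :
    ∫⁻ s in Ioi (0 : ℝ), ENNReal.ofReal
        (p * (p - 1) * (2 - p) / 2 * s ^ (p - 3) * (t ^ 2 - max (t - s) 0 ^ 2)) =
      ENNReal.ofReal (t ^ p) := by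
  rcases ht.eq_or_lt with rfl | ht
  · rw [Real.zero_rpow (by linarith), ENNReal.ofReal_zero,
      setLIntegral_congr_fun (g := fun _ => 0) measurableSet_Ioi, lintegral_zero]
    intro s hs
    have : -s ≤ 0 := by simp only [mem_Ioi] at hs; linarith
    simp [max_eq_right this]
  have hc : 0 ≤ p * (p - 1) * (2 - p) / 2 := by
    have := mul_nonneg (mul_nonneg (by linarith : 0 ≤ p) (by linarith : 0 ≤ p - 1))
      (by linarith : 0 ≤ 2 - p)
    linarith
  have hpos : ∀ s : ℝ, 0 < s →
      0 ≤ p * (p - 1) * (2 - p) / 2 * s ^ (p - 3) * (t ^ 2 - max (t - s) 0 ^ 2) := by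
    intro s hs
    refine mul_nonneg (mul_nonneg hc (Real.rpow_nonneg hs.le _)) (sub_nonneg.2 ?_)
    exact pow_le_pow_left₀ (le_max_right _ _) (max_le (by linarith) ht.le) 2
  rw [← Ioc_union_Ioi_eq_Ioi ht.le, lintegral_union measurableSet_Ioi (Ioc_disjoint_Ioi le_rfl)]
  have e₁ : ∀ s ∈ Ioc 0 t,
      p * (p - 1) * (2 - p) / 2 * s ^ (p - 3) * (t ^ 2 - max (t - s) 0 ^ 2) =
      p * (p - 1) * (2 - p) / 2 * (2 * t * s ^ (p - 2) - s ^ (p - 1)) := by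
    intro s hs
    rw [max_eq_left (by linarith [hs.2]), show p - 2 = p - 3 + 1 by ring,
      show p - 1 = p - 3 + 2 by ring, Real.rpow_add hs.1, Real.rpow_add hs.1, Real.rpow_one,
      Real.rpow_two]
    ring
  have e₂ : ∀ s ∈ Ioi t,
      p * (p - 1) * (2 - p) / 2 * s ^ (p - 3) * (t ^ 2 - max (t - s) 0 ^ 2) =
      p * (p - 1) * (2 - p) / 2 * (t ^ 2 * s ^ (p - 3)) := by
    intro s hs
    have : t - s ≤ 0 := by simp only [mem_Ioi] at hs; linarith
    rw [max_eq_right this]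
    ring
  have i₁ := (integrableOn_Ioc_rpow (show -1 < p - 2 by linarith) t).const_mul (2 * t)
  have i₂ := integrableOn_Ioc_rpow (show -1 < p - 1 by linarith) t
  have i₃ := (integrableOn_Ioi_rpow_of_lt (show p - 3 < -1 by linarith) ht).const_mul (t ^ 2)
  have hp1 : p - 1 ≠ 0 := by linarith
  have hp2 : 2 - p ≠ 0 := by linarith
  have hp2' : p - 2 ≠ 0 := by linarith
  have hp0 : p ≠ 0 := by linarith
  have l₁ : ∫⁻ s in Ioc 0 t, ENNReal.ofReal
      (p * (p - 1) * (2 - p) / 2 * s ^ (p - 3) * (t ^ 2 - max (t - s) 0 ^ 2)) =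
      ENNReal.ofReal (p * (p - 1) * (2 - p) / 2 * (2 * t ^ p / (p - 1) - t ^ p / p)) := by
    refine lintegral_ofReal_eq_of_integral ?_ ?_ ?_
    · exact ((i₁.sub i₂).const_mul (p * (p - 1) * (2 - p) / 2)).congr
        ((ae_restrict_iff' measurableSet_Ioc).2 (.of_forall fun s hs => (e₁ s hs).symm))
    · exact (ae_restrict_iff' measurableSet_Ioc).2 (.of_forall fun s hs => hpos s hs.1)
    · rw [setIntegral_congr_fun measurableSet_Ioc e₁, integral_const_mul, integral_sub i₁ i₂,
        integral_const_mul, integral_Ioc_rpow (by linarith) ht.le,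
        integral_Ioc_rpow (by linarith) ht.le]
      have h₂ : t ^ (p - 2 + 1) = t ^ p / t := by
        nth_rw 3 [← Real.rpow_one t]
        rw [← Real.rpow_sub ht]; ring_nf
      rw [h₂, sub_add_cancel, show p - 2 + 1 = p - 1 by ring]
      field_simp
  have l₂ : ∫⁻ s in Ioi t, ENNReal.ofReal
      (p * (p - 1) * (2 - p) / 2 * s ^ (p - 3) * (t ^ 2 - max (t - s) 0 ^ 2)) =
      ENNReal.ofReal (p * (p - 1) * (2 - p) / 2 * (t ^ p / (2 - p))) := by
    refine lintegral_ofReal_eq_of_integral ?_ ?_ ?_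
    · exact (i₃.const_mul (p * (p - 1) * (2 - p) / 2)).congr
        ((ae_restrict_iff' measurableSet_Ioi).2 (.of_forall fun s hs => (e₂ s hs).symm))
    · exact (ae_restrict_iff' measurableSet_Ioi).2
        (.of_forall fun s hs => hpos s (ht.trans hs))
    · rw [setIntegral_congr_fun measurableSet_Ioi e₂, integral_const_mul,
        integral_const_mul, integral_Ioi_rpow_of_lt (by linarith) ht]
      have h₁ : t ^ (p - 3 + 1) = t ^ p / t ^ 2 := by
        rw [← Real.rpow_two, ← Real.rpow_sub ht]; ring_nf
      rw [h₁, show p - 3 + 1 = -(2 - p) by ring]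
      field_simp
  have hP := Real.rpow_nonneg ht.le p
  rw [l₁, l₂, ← ENNReal.ofReal_add]
  · congr 1
    field_simp
    ring
  · refine mul_nonneg hc ?_
    rw [show 2 * t ^ p / (p - 1) - t ^ p / p = t ^ p * ((p + 1) / ((p - 1) * p)) by
      field_simp; ring]
    have : 0 < p - 1 := by linarith
    positivity
  · have : 0 < 2 - p := by linarith
    positivity

lemma lintegral_rpow_mul_exp_neg {p N : ℝ} (hp : 2 < p) (hN : 0 < N) :
    ∫⁻ s in Ioi (0 : ℝ), ENNReal.ofReal
        (p * (p - 1) * (p - 2) / 2 * s ^ (p - 3) * Real.exp (-s / N)) =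
      ENNReal.ofReal (p / 2 * Real.Gamma p * N ^ (p - 2)) := by
  have hc : 0 < p * (p - 1) * (p - 2) / 2 := by
    have := mul_pos (mul_pos (by linarith : 0 < p) (by linarith : 0 < p - 1))
      (by linarith : 0 < p - 2)
    linarith
  have hI : ∫ s in Ioi (0 : ℝ), p * (p - 1) * (p - 2) / 2 * s ^ (p - 3) * Real.exp (-s / N) =
      p / 2 * Real.Gamma p * N ^ (p - 2) := by
    have h₁ := Real.integral_rpow_mul_exp_neg_mul_Ioi (show 0 < p - 2 by linarith)
      (inv_pos.2 hN)
    have h₂ : Real.Gamma p = (p - 1) * ((p - 2) * Real.Gamma (p - 2)) := by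
      rw [← Real.Gamma_add_one (by linarith), show p - 2 + 1 = p - 1 by ring,
        ← Real.Gamma_add_one (by linarith), sub_add_cancel]
    simp_rw [mul_assoc (p * (p - 1) * (p - 2) / 2)]
    rw [integral_const_mul, h₂]
    rw [one_div, inv_inv] at h₁
    have h₃ : ∫ s in Ioi (0 : ℝ), s ^ (p - 3) * Real.exp (-s / N) =
        N ^ (p - 2) * Real.Gamma (p - 2) := by
      rw [← h₁]
      refine setIntegral_congr_fun measurableSet_Ioi fun s _ => ?_
      rw [show p - 2 - 1 = p - 3 by ring, neg_div, div_eq_inv_mul]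
    rw [h₃]
    ring
  refine lintegral_ofReal_eq_of_integral ?_ ?_ hI
  -- A nonzero integral certifies integrability, since a non-integrable function has integral `0` by
  -- convention.
  · refine not_imp_comm.1 integral_undef ?_
    rw [hI]
    have := Real.Gamma_pos_of_pos (show 0 < p by linarith)
    have := Real.rpow_pos_of_pos hN (p - 2)
    positivity
  · refine (ae_restrict_iff' measurableSet_Ioi).2 (.of_forall fun s hs => ?_)
    have := Real.rpow_nonneg (le_of_lt hs) (p - 3)
    simp only [Pi.zero_apply]
    positivity

lemma one_sub_exp_neg_bounds {r s : ℝ} (hr : 0 < r) (hs : 0 ≤ s) :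
    0 ≤ 1 - Real.exp (-(r * s)) ∧ 1 - Real.exp (-(r * s)) ≤ 1 ∧
      1 - Real.exp (-(r * s)) ≤ r * s := by
  refine ⟨?_, by linarith [Real.exp_pos (-(r * s))], ?_⟩
  · have : Real.exp (-(r * s)) ≤ 1 := Real.exp_le_one_iff.2 (by nlinarith)
    linarith
  · linarith [Real.add_one_le_exp (-(r * s))]

lemma integrableOn_rpow_mul_one_sub_exp {p r : ℝ} (hp : 1 < p) (hp' : p < 2) (hr : 0 < r) :
    IntegrableOn (fun s : ℝ => s ^ (p - 3) * (1 - Real.exp (-(r * s)))) (Ioi 0) := by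
  have hm : Measurable (fun s : ℝ => s ^ (p - 3) * (1 - Real.exp (-(r * s)))) := by fun_prop
  rw [← Ioc_union_Ioi_eq_Ioi (zero_le_one' ℝ)]
  refine IntegrableOn.union ?_ ?_
  · refine Integrable.mono' ((integrableOn_Ioc_rpow (show -1 < p - 2 by linarith) 1).const_mul r)
      hm.aestronglyMeasurable ((ae_restrict_iff' measurableSet_Ioc).2 (.of_forall fun s hs => ?_))
    obtain ⟨h₁, -, h₃⟩ := one_sub_exp_neg_bounds hr hs.1.le
    have h₄ := Real.rpow_nonneg hs.1.le (p - 3)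
    rw [Real.norm_of_nonneg (mul_nonneg h₄ h₁), show p - 2 = p - 3 + 1 by ring,
      Real.rpow_add hs.1, Real.rpow_one]
    nlinarith [mul_le_mul_of_nonneg_left h₃ h₄]
  · refine Integrable.mono' (integrableOn_Ioi_rpow_of_lt (show p - 3 < -1 by linarith) one_pos)
      hm.aestronglyMeasurable ((ae_restrict_iff' measurableSet_Ioi).2 (.of_forall fun s hs => ?_))
    have hs : 0 ≤ s := zero_le_one.trans (le_of_lt hs)
    obtain ⟨h₁, h₂, -⟩ := one_sub_exp_neg_bounds hr hs
    have h₄ := Real.rpow_nonneg hs (p - 3)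
    rw [Real.norm_of_nonneg (mul_nonneg h₄ h₁)]
    nlinarith [mul_le_mul_of_nonneg_left h₂ h₄]

lemma integral_rpow_mul_one_sub_exp {p r : ℝ} (hp : 1 < p) (hp' : p < 2) (hr : 0 < r) :
    ∫ s in Ioi (0 : ℝ), s ^ (p - 3) * (1 - Real.exp (-(r * s))) =
      (1 / r) ^ (p - 2) * Real.Gamma (p - 1) / (2 - p) := by
  have h₁ := Real.integral_rpow_mul_exp_neg_mul_Ioi (show 0 < p - 1 by linarith) hr
  rw [show p - 1 - 1 = p - 2 by ring] at h₁
  have hG := Real.Gamma_pos_of_pos (show 0 < p - 1 by linarith)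
  have hi : IntegrableOn (fun s : ℝ => s ^ (p - 2) * Real.exp (-(r * s))) (Ioi 0) := by
    refine not_imp_comm.1 integral_undef ?_
    rw [h₁]
    positivity
  have hi' := integrableOn_rpow_mul_one_sub_exp hp hp' hr
  have hp2 : p - 2 ≠ 0 := by linarith
  -- `F` is the boundary term of an integration by parts; it vanishes at both ends because `1 < p <
  -- 2`, reducing the integral to the Gamma integral with exponent `p - 1`.
  set F : ℝ → ℝ := fun s => s ^ (p - 2) * (1 - Real.exp (-(r * s))) / (p - 2) with hF
  have hd : ∀ s ∈ Ioi (0 : ℝ), HasDerivAt F (s ^ (p - 3) * (1 - Real.exp (-(r * s))) +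
      r / (p - 2) * (s ^ (p - 2) * Real.exp (-(r * s)))) s := by
    intro s hs
    have d₁ : HasDerivAt (fun s : ℝ => s ^ (p - 2)) ((p - 2) * s ^ (p - 2 - 1)) s :=
      Real.hasDerivAt_rpow_const (Or.inl (ne_of_gt hs))
    have d₂ : HasDerivAt (fun s : ℝ => 1 - Real.exp (-(r * s)))
        (-(Real.exp (-(r * s)) * (-(r * 1)))) s :=
      ((((hasDerivAt_id s).const_mul r).neg).exp).const_sub 1
    refine ((d₁.mul d₂).div_const (p - 2)).congr_deriv ?_
    rw [show p - 2 - 1 = p - 3 by ring]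
    field_simp
  have hFb : ∀ s : ℝ, 0 < s → |F s| ≤ s ^ (p - 2) / (2 - p) ∧
      |F s| ≤ r * s ^ (p - 1) / (2 - p) := by
    intro s hs
    obtain ⟨b₁, b₂, b₃⟩ := one_sub_exp_neg_bounds hr hs.le
    have h₄ := Real.rpow_nonneg hs.le (p - 2)
    have h₅ : 0 < 2 - p := by linarith
    have : |F s| = s ^ (p - 2) * (1 - Real.exp (-(r * s))) / (2 - p) := by
      rw [hF, abs_div, abs_of_nonneg (mul_nonneg h₄ b₁), abs_of_neg (by linarith : p - 2 < 0),
        neg_sub]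
    rw [this]
    constructor
    · refine div_le_div_of_nonneg_right ?_ h₅.le
      nlinarith [mul_le_mul_of_nonneg_left b₂ h₄]
    · refine div_le_div_of_nonneg_right ?_ h₅.le
      rw [show p - 1 = p - 2 + 1 by ring, Real.rpow_add hs, Real.rpow_one]
      nlinarith [mul_le_mul_of_nonneg_left b₃ h₄]
  have hF0 : F 0 = 0 := by simp [hF]
  have hc : ContinuousWithinAt F (Ici 0) 0 := by
    rw [← continuousWithinAt_Ioi_iff_Ici, ContinuousWithinAt, hF0]
    refine squeeze_zero_norm' (a := fun s => r * s ^ (p - 1) / (2 - p))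
      (eventually_mem_nhdsWithin.mono fun s hs => (hFb s hs).2) ?_
    have : Tendsto (fun s : ℝ => r * s ^ (p - 1) / (2 - p)) (𝓝 0) (𝓝 (r * 0 ^ (p - 1) / (2 - p))) :=
      ((Real.continuousAt_rpow_const 0 (p - 1) (Or.inr (by linarith))).tendsto.const_mul r).div_const _
    rw [Real.zero_rpow (by linarith), mul_zero, zero_div] at this
    exact this.mono_left nhdsWithin_le_nhds
  have hinf : Tendsto F atTop (𝓝 0) := by
    refine squeeze_zero_norm' (a := fun s => s ^ (p - 2) / (2 - p))
      ((eventually_gt_atTop 0).mono fun s hs => (hFb s hs).1) ?_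
    have := (tendsto_rpow_neg_atTop (show 0 < 2 - p by linarith)).div_const (2 - p)
    rw [zero_div, neg_sub] at this
    exact this
  have hFTC := integral_Ioi_of_hasDerivAt_of_tendsto hc hd (hi'.add (hi.const_mul _)) hinf
  rw [hF0, integral_add hi' (hi.const_mul _), integral_const_mul, h₁] at hFTC
  have e : (1 / r) ^ (p - 1) = (1 / r) ^ (p - 2) * (1 / r) := by
    rw [show p - 1 = p - 2 + 1 by ring, Real.rpow_add (by positivity), Real.rpow_one]
  rw [e] at hFTC
  rw [eq_sub_of_add_eq hFTC, show 2 - p = -(p - 2) by ring]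
  field_simp
  ring

lemma lintegral_rpow_mul_one_sub_exp {p N : ℝ} (hp : 1 < p) (hp' : p < 2) (hN : 0 < N) :
    ∫⁻ s in Ioi (0 : ℝ), ENNReal.ofReal
        (p * (p - 1) * (2 - p) / 2 * s ^ (p - 3) * (1 - Real.exp (-s / N))) =
      ENNReal.ofReal (p / 2 * Real.Gamma p * N ^ (p - 2)) := by
  have hc : 0 ≤ p * (p - 1) * (2 - p) / 2 := by
    have := mul_nonneg (mul_nonneg (by linarith : 0 ≤ p) (by linarith : 0 ≤ p - 1))
      (by linarith : 0 ≤ 2 - p)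
    linarith
  have e : ∀ s : ℝ, p * (p - 1) * (2 - p) / 2 * s ^ (p - 3) * (1 - Real.exp (-s / N)) =
      p * (p - 1) * (2 - p) / 2 * (s ^ (p - 3) * (1 - Real.exp (-(N⁻¹ * s)))) := by
    intro s
    rw [neg_div, div_eq_inv_mul s N, mul_assoc]
  simp_rw [e]
  refine lintegral_ofReal_eq_of_integral
    ((integrableOn_rpow_mul_one_sub_exp hp hp' (inv_pos.2 hN)).const_mul _) ?_ ?_
  · refine (ae_restrict_iff' measurableSet_Ioi).2 (.of_forall fun s hs => ?_)
    have h₁ := (one_sub_exp_neg_bounds (inv_pos.2 hN) (le_of_lt hs)).1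
    have h₂ := Real.rpow_nonneg (le_of_lt hs) (p - 3)
    exact mul_nonneg hc (mul_nonneg h₂ h₁)
  · have h₂ : Real.Gamma p = (p - 1) * Real.Gamma (p - 1) := by
      rw [← Real.Gamma_add_one (by linarith), sub_add_cancel]
    rw [integral_const_mul, integral_rpow_mul_one_sub_exp hp hp' (inv_pos.2 hN), h₂, one_div,
      inv_inv]
    have : 2 - p ≠ 0 := by linarith
    field_simp

/-! ### From exponential decay of truncations to moments. -/

section

variable {α : Type*} [MeasurableSpace α] {μ : Measure α} {g : α → ℝ} {M N : ℝ}

lemma lintegral_rpow_le_of_truncation [SFinite μ] (hg : AEMeasurable g μ) (hg0 : ∀ x, 0 ≤ g x) (hN : 0 < N)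
    (hM : 0 ≤ M)
    (h : ∀ s, 0 ≤ s → ∫⁻ x, ENNReal.ofReal (max (g x - s) 0 ^ 2) ∂μ ≤
      ENNReal.ofReal (Real.exp (-s / N) * M)) {p : ℝ} (hp : 2 < p) :
    ∫⁻ x, ENNReal.ofReal (g x ^ p) ∂μ ≤
      ENNReal.ofReal (p / 2 * Real.Gamma p * N ^ (p - 2) * M) := by
  have hc : 0 ≤ p * (p - 1) * (p - 2) / 2 := by
    have := mul_nonneg (mul_nonneg (by linarith : 0 ≤ p) (by linarith : 0 ≤ p - 1))
      (by linarith : 0 ≤ p - 2)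
    linarith
  simp_rw [← fun x => lintegral_truncation_rpow hp (hg0 x)]
  rw [lintegral_lintegral_swap]
  · calc _ ≤ ∫⁻ s in Ioi (0 : ℝ), ENNReal.ofReal
            (p * (p - 1) * (p - 2) / 2 * s ^ (p - 3) * Real.exp (-s / N)) *
              ENNReal.ofReal M := by
          refine setLIntegral_mono' measurableSet_Ioi fun s hs => ?_
          have h₁ : 0 ≤ p * (p - 1) * (p - 2) / 2 * s ^ (p - 3) :=
            mul_nonneg hc (Real.rpow_nonneg (le_of_lt hs) _)
          simp_rw [ENNReal.ofReal_mul h₁]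
          rw [lintegral_const_mul' _ _ ENNReal.ofReal_ne_top, mul_assoc (ENNReal.ofReal _),
            ← ENNReal.ofReal_mul (Real.exp_pos _).le]
          exact mul_le_mul_right (h s (le_of_lt hs)) _
      _ = _ := by
          rw [lintegral_mul_const' _ _ ENNReal.ofReal_ne_top, lintegral_rpow_mul_exp_neg hp hN,
            ← ENNReal.ofReal_mul' hM]
  · have h₁ : AEMeasurable (fun q : α × ℝ => g q.1) (μ.prod (volume.restrict (Ioi 0))) :=
      hg.comp_fst
    simp only [Function.uncurry_def]
    fun_prop

lemma ofReal_le_lintegral_sq_sub_truncation (hg : AEMeasurable g μ) (hg0 : ∀ x, 0 ≤ g x)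
    (hM : 0 ≤ M) (hgM : ∫⁻ x, ENNReal.ofReal (g x ^ 2) ∂μ = ENNReal.ofReal M)
    (h : ∀ s, 0 ≤ s → ∫⁻ x, ENNReal.ofReal (max (g x - s) 0 ^ 2) ∂μ ≤
      ENNReal.ofReal (Real.exp (-s / N) * M)) {s : ℝ} (hs : 0 ≤ s) :
    ENNReal.ofReal ((1 - Real.exp (-s / N)) * M) ≤
      ∫⁻ x, ENNReal.ofReal (g x ^ 2 - max (g x - s) 0 ^ 2) ∂μ := by
  rw [sub_mul, one_mul, ENNReal.ofReal_sub _ (mul_nonneg (Real.exp_pos _).le hM),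
    tsub_le_iff_right, ← hgM]
  refine le_trans (le_of_eq ?_) (add_le_add_right (h s hs) _)
  rw [← lintegral_add_left' (by fun_prop)]
  refine lintegral_congr fun x => ?_
  rw [← ENNReal.ofReal_add _ (sq_nonneg _), sub_add_cancel]
  exact sub_nonneg.2 (pow_le_pow_left₀ (le_max_right _ _) (max_le (by linarith) (hg0 x)) 2)

lemma le_lintegral_rpow_of_truncation [SFinite μ] (hg : AEMeasurable g μ) (hg0 : ∀ x, 0 ≤ g x) (hN : 0 < N)
    (hM : 0 ≤ M) (hgM : ∫⁻ x, ENNReal.ofReal (g x ^ 2) ∂μ = ENNReal.ofReal M)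
    (h : ∀ s, 0 ≤ s → ∫⁻ x, ENNReal.ofReal (max (g x - s) 0 ^ 2) ∂μ ≤
      ENNReal.ofReal (Real.exp (-s / N) * M)) {p : ℝ} (hp : 1 < p) (hp' : p < 2) :
    ENNReal.ofReal (p / 2 * Real.Gamma p * N ^ (p - 2) * M) ≤
      ∫⁻ x, ENNReal.ofReal (g x ^ p) ∂μ := by
  have hc : 0 ≤ p * (p - 1) * (2 - p) / 2 := by
    have := mul_nonneg (mul_nonneg (by linarith : 0 ≤ p) (by linarith : 0 ≤ p - 1))
      (by linarith : 0 ≤ 2 - p)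
    linarith
  simp_rw [← fun x => lintegral_sq_sub_truncation_rpow hp hp' (hg0 x)]
  rw [lintegral_lintegral_swap]
  · calc _ = ∫⁻ s in Ioi (0 : ℝ), ENNReal.ofReal
            (p * (p - 1) * (2 - p) / 2 * s ^ (p - 3) * (1 - Real.exp (-s / N))) *
              ENNReal.ofReal M := by
          rw [lintegral_mul_const' _ _ ENNReal.ofReal_ne_top,
            lintegral_rpow_mul_one_sub_exp hp hp' hN, ← ENNReal.ofReal_mul' hM]
      _ ≤ _ := by
          refine setLIntegral_mono' measurableSet_Ioi fun s hs => ?_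
          have h₁ : 0 ≤ p * (p - 1) * (2 - p) / 2 * s ^ (p - 3) :=
            mul_nonneg hc (Real.rpow_nonneg (le_of_lt hs) _)
          simp_rw [ENNReal.ofReal_mul h₁]
          rw [lintegral_const_mul' _ _ ENNReal.ofReal_ne_top, mul_assoc (ENNReal.ofReal _),
            ← ENNReal.ofReal_mul' hM]
          exact mul_le_mul_right
            (ofReal_le_lintegral_sq_sub_truncation hg hg0 hM hgM h (le_of_lt hs)) _
  · have h₁ : AEMeasurable (fun q : α × ℝ => g q.1) (μ.prod (volume.restrict (Ioi 0))) :=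
      hg.comp_fst
    simp only [Function.uncurry_def]
    fun_prop

/-- Pointwise `g² - (g - s)₊² ≤ 2 * s * g`. Dividing the lower bound for the left side by `2 * s`
and letting `s → 0` leaves the slope `1 / N` of `1 - exp (-s / N)` at `0`. -/
lemma le_lintegral_of_truncation (hg : AEMeasurable g μ) (hg0 : ∀ x, 0 ≤ g x)
    (hM : 0 ≤ M) (hgM : ∫⁻ x, ENNReal.ofReal (g x ^ 2) ∂μ = ENNReal.ofReal M)
    (h : ∀ s, 0 ≤ s → ∫⁻ x, ENNReal.ofReal (max (g x - s) 0 ^ 2) ∂μ ≤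
      ENNReal.ofReal (Real.exp (-s / N) * M)) :
    ENNReal.ofReal (M / (2 * N)) ≤ ∫⁻ x, ENNReal.ofReal (g x) ∂μ := by
  have key : ∀ s : ℝ, 0 < s →
      ENNReal.ofReal ((1 - Real.exp (-s / N)) / s * (M / 2)) ≤ ∫⁻ x, ENNReal.ofReal (g x) ∂μ := by
    intro s hs
    have h₁ : ENNReal.ofReal ((1 - Real.exp (-s / N)) * M) ≤
        ENNReal.ofReal (2 * s) * ∫⁻ x, ENNReal.ofReal (g x) ∂μ := by
      refine (ofReal_le_lintegral_sq_sub_truncation hg hg0 hM hgM h hs.le).trans ?_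
      rw [← lintegral_const_mul' _ _ ENNReal.ofReal_ne_top]
      refine lintegral_mono fun x => ?_
      simp only
      rw [← ENNReal.ofReal_mul (by positivity)]
      apply ENNReal.ofReal_le_ofReal
      rcases le_total (g x) s with h₂ | h₂
      · rw [max_eq_right (by linarith)]
        nlinarith [hg0 x]
      · rw [max_eq_left (by linarith)]
        nlinarith
    have h₂ : (1 - Real.exp (-s / N)) / s * (M / 2) =
        (2 * s)⁻¹ * ((1 - Real.exp (-s / N)) * M) := by field_simp
    have h₃ : ENNReal.ofReal (2 * s)⁻¹ * ENNReal.ofReal (2 * s) = 1 := by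
      rw [← ENNReal.ofReal_mul (by positivity), inv_mul_cancel₀ (by positivity),
        ENNReal.ofReal_one]
    rw [h₂, ENNReal.ofReal_mul (by positivity)]
    calc _ ≤ ENNReal.ofReal (2 * s)⁻¹ *
          (ENNReal.ofReal (2 * s) * ∫⁻ x, ENNReal.ofReal (g x) ∂μ) := mul_le_mul_right h₁ _
      _ = _ := by rw [← mul_assoc, h₃, one_mul]
  refine le_of_tendsto (x := 𝓝[>] (0 : ℝ))
    (f := fun s => ENNReal.ofReal ((1 - Real.exp (-s / N)) / s * (M / 2))) ?_
    (eventually_mem_nhdsWithin.mono key)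
  refine ENNReal.tendsto_ofReal ?_
  have hd : HasDerivAt (fun s : ℝ => 1 - Real.exp (-s / N)) (1 / N) 0 := by
    have := (((hasDerivAt_id (0 : ℝ)).neg.div_const N).exp).const_sub 1
    refine this.congr_deriv ?_
    simp [neg_div]
  have := hd.tendsto_slope_zero_right.mul_const (M / 2)
  rw [show M / (2 * N) = 1 / N * (M / 2) by ring]
  refine this.congr fun s => ?_
  simp only [zero_add, neg_zero, zero_div, Real.exp_zero, sub_self, sub_zero, smul_eq_mul]
  ring

end

/-! ### The inequalities for the `p`-oscillation. -/

lemma mul_avg {f : ℝ → ℝ} {a b : ℝ} (hab : a < b) :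
    (b - a) * avg f a b = ∫ t in Ioo a b, f t := by
  rw [avg_eq_setIntegral _ hab.le, mul_inv_cancel_left₀ (sub_pos.2 hab).ne']

lemma avg_mono {f g : ℝ → ℝ} {a b : ℝ} (hab : a < b) (hf : IntegrableOn f (Ioo a b))
    (hg : IntegrableOn g (Ioo a b)) (h : ∀ t, f t ≤ g t) : avg f a b ≤ avg g a b := by
  rw [avg_eq_setIntegral _ hab.le, avg_eq_setIntegral _ hab.le]
  exact mul_le_mul_of_nonneg_left (integral_mono hf hg h) (inv_nonneg.2 (sub_pos.2 hab).le)

lemma avg_sub {f g : ℝ → ℝ} {a b : ℝ} (hab : a < b) (hf : IntegrableOn f (Ioo a b))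
    (hg : IntegrableOn g (Ioo a b)) : avg (f - g) a b = avg f a b - avg g a b := by
  rw [avg_eq_setIntegral _ hab.le, avg_eq_setIntegral _ hab.le, avg_eq_setIntegral _ hab.le,
    integral_sub' hf hg, mul_sub]

lemma avg_le_of_lintegral_le {f : ℝ → ℝ} {a b C : ℝ} (hab : a < b) (hf : ∀ t, 0 ≤ f t)
    (hi : IntegrableOn f (Ioo a b)) (hC : 0 ≤ C)
    (h : ∫⁻ t in Ioo a b, ENNReal.ofReal (f t) ≤ ENNReal.ofReal (C * (b - a))) :
    avg f a b ≤ C := by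
  have hL := sub_pos.2 hab
  rw [← ofReal_integral_eq_lintegral_ofReal hi (.of_forall hf),
    ENNReal.ofReal_le_ofReal_iff (by positivity), ← mul_avg hab, mul_comm C] at h
  exact le_of_mul_le_mul_left h hL

lemma le_avg_of_le_lintegral {f : ℝ → ℝ} {a b C : ℝ} (hab : a < b) (hf : ∀ t, 0 ≤ f t)
    (hi : IntegrableOn f (Ioo a b))
    (h : ENNReal.ofReal (C * (b - a)) ≤ ∫⁻ t in Ioo a b, ENNReal.ofReal (f t)) :
    C ≤ avg f a b := by
  have hL := sub_pos.2 hab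
  rw [← ofReal_integral_eq_lintegral_ofReal hi (.of_forall hf),
    ENNReal.ofReal_le_ofReal_iff (integral_nonneg hf), ← mul_avg hab, mul_comm C] at h
  exact le_of_mul_le_mul_left h hL

/-- Weighted AM-GM applied to `u ^ (p - 1)` and `u`, with weights chosen so that the geometric mean
is `1`. Equality holds at `u = 0` and `u = 1`, which is what makes `threeStep` extremal. -/
lemma rpow_ge_quadratic {p u : ℝ} (hp : 0 < p) (hp' : p ≤ 1) (hu : 0 ≤ u) :
    (2 - p) * u - (1 - p) * u ^ 2 ≤ u ^ p := by
  rcases hu.eq_or_lt with rfl | hu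
  · simp [Real.zero_rpow hp.ne']
  have h2p : 0 < 2 - p := by linarith
  have h := Real.geom_mean_le_arith_mean2_weighted (w₁ := 1 / (2 - p)) (w₂ := (1 - p) / (2 - p))
    (p₁ := u ^ (p - 1)) (p₂ := u) (by positivity) (div_nonneg (by linarith) h2p.le)
    (by positivity) hu.le (by field_simp; ring)
  rw [← Real.rpow_mul hu.le, ← Real.rpow_add hu,
    show (p - 1) * (1 / (2 - p)) + (1 - p) / (2 - p) = 0 by field_simp; ring, Real.rpow_zero] at h
  have h' : 2 - p ≤ u ^ (p - 1) + (1 - p) * u := by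
    have := mul_le_mul_of_nonneg_left h h2p.le
    field_simp at this
    linarith
  have e : u ^ p = u ^ (p - 1) * u := by
    nth_rw 3 [← Real.rpow_one u]
    rw [← Real.rpow_add hu, sub_add_cancel]
  rw [e]
  nlinarith [mul_le_mul_of_nonneg_right h' hu.le]

section

variable {φ : ℝ → ℝ} {a b N : ℝ}

lemma OscBoundedBy.aemeasurable_deviation {κ : ℝ} (h : OscBoundedBy κ φ a b) (m : ℝ) :
    AEMeasurable (fun t => |φ t - m|) (volume.restrict (Ioo a b)) := by
  have := h.integrable.aestronglyMeasurable.aemeasurable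
  fun_prop

lemma OscBoundedBy.integrable_deviation_sq {κ : ℝ} (h : OscBoundedBy κ φ a b) (m : ℝ) :
    IntegrableOn (fun t => |φ t - m| ^ 2) (Ioo a b) := by
  simpa using (h.const_mul_sub 1 m).integrable_sq

lemma OscBoundedBy.lintegral_deviation_sq {κ : ℝ} (h : OscBoundedBy κ φ a b) (hab : a < b) :
    ∫⁻ t in Ioo a b, ENNReal.ofReal (|φ t - avg φ a b| ^ 2) =
      ENNReal.ofReal ((b - a) * osc2 φ a b) := by
  refine lintegral_ofReal_eq_of_integral (h.integrable_deviation_sq _)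
    (.of_forall fun t => sq_nonneg _) ?_
  simp_rw [sq_abs]
  rw [← mul_avg hab, avg_sub_const_sq hab h.integrable h.integrable_sq, sub_self]
  simp

lemma OscBoundedBy.pOsc_two {κ : ℝ} (h : OscBoundedBy κ φ a b) (hab : a < b) :
    pOsc 2 φ a b = osc2 φ a b := by
  simp_rw [pOsc, Real.rpow_two, sq_abs]
  rw [avg_sub_const_sq hab h.integrable h.integrable_sq, sub_self]
  simp

lemma OscBoundedBy.lintegral_deviation_rpow_le (h : OscBoundedBy (N ^ 2) φ a b) (hN : 0 < N)
    (hab : a < b) {p : ℝ} (hp : 2 < p) :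
    ∫⁻ t in Ioo a b, ENNReal.ofReal (|φ t - avg φ a b| ^ p) ≤
      ENNReal.ofReal (p / 2 * Real.Gamma p * N ^ (p - 2) * ((b - a) * osc2 φ a b)) :=
  lintegral_rpow_le_of_truncation (h.aemeasurable_deviation _) (fun _ => abs_nonneg _) hN
    (mul_nonneg (sub_pos.2 hab).le (h.nonneg le_rfl hab le_rfl))
    (fun _ hs => h.lintegral_truncation_sub_avg_le hN hab hs) hp

lemma OscBoundedBy.integrable_deviation_rpow (h : OscBoundedBy (N ^ 2) φ a b) (hN : 0 < N)
    (hab : a < b) {p : ℝ} (hp : 0 < p) :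
    IntegrableOn (fun t => |φ t - avg φ a b| ^ p) (Ioo a b) := by
  have hm : AEStronglyMeasurable (fun t => |φ t - avg φ a b| ^ p)
      (volume.restrict (Ioo a b)) :=
    ((h.aemeasurable_deviation _).pow_const p).aestronglyMeasurable
  have h0 : ∀ t, 0 ≤ |φ t - avg φ a b| ^ p := fun t => Real.rpow_nonneg (abs_nonneg _) _
  rcases le_or_gt p 2 with h2 | h2
  · have hi : IntegrableOn (fun t => 1 + |φ t - avg φ a b| ^ 2) (Ioo a b) :=
      Integrable.add (by simp) (h.integrable_deviation_sq _)
    refine Integrable.mono' hi hm (.of_forall fun t => ?_)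
    rw [Real.norm_of_nonneg (h0 t)]
    rcases le_total |φ t - avg φ a b| 1 with h1 | h1
    · have := Real.rpow_le_one (abs_nonneg _) h1 hp.le
      linarith [sq_nonneg |φ t - avg φ a b|]
    · have := Real.rpow_le_rpow_of_exponent_le h1 h2
      rw [Real.rpow_two] at this
      linarith
  · refine (lintegral_ofReal_ne_top_iff_integrable hm (.of_forall h0)).1 ?_
    exact ((h.lintegral_deviation_rpow_le hN hab h2).trans_lt ENNReal.ofReal_lt_top).ne

lemma OscBoundedBy.pOsc_le (h : OscBoundedBy (N ^ 2) φ a b) (hN : 0 < N)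
    (hab : a < b) {p : ℝ} (hp : 2 ≤ p) :
    pOsc p φ a b ≤ p / 2 * Real.Gamma p * N ^ (p - 2) * osc2 φ a b := by
  rcases hp.eq_or_lt with rfl | hp
  · rw [h.pOsc_two hab]; simp
  have hV := h.nonneg le_rfl hab le_rfl
  have hG := Real.Gamma_pos_of_pos (show 0 < p by linarith)
  refine avg_le_of_lintegral_le hab (fun t => Real.rpow_nonneg (abs_nonneg _) _)
    (h.integrable_deviation_rpow hN hab (by linarith)) (by positivity) ?_
  refine (h.lintegral_deviation_rpow_le hN hab hp).trans (le_of_eq ?_)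
  congr 1
  ring

lemma OscBoundedBy.osc2_div_le_pOsc_one (h : OscBoundedBy (N ^ 2) φ a b) (hN : 0 < N)
    (hab : a < b) : osc2 φ a b / (2 * N) ≤ pOsc 1 φ a b := by
  refine le_avg_of_le_lintegral hab (fun t => Real.rpow_nonneg (abs_nonneg _) _)
    (h.integrable_deviation_rpow hN hab one_pos) ?_
  simp_rw [Real.rpow_one]
  refine le_trans (le_of_eq ?_) (le_lintegral_of_truncation (h.aemeasurable_deviation _)
    (fun _ => abs_nonneg _) (mul_nonneg (sub_pos.2 hab).le (h.nonneg le_rfl hab le_rfl))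
    (h.lintegral_deviation_sq hab) (fun _ hs => h.lintegral_truncation_sub_avg_le hN hab hs))
  congr 1
  ring

lemma OscBoundedBy.le_pOsc (h : OscBoundedBy (N ^ 2) φ a b) (hN : 0 < N)
    (hab : a < b) {p : ℝ} (hp : 1 ≤ p) (hp' : p ≤ 2) :
    p / 2 * Real.Gamma p * N ^ (p - 2) * osc2 φ a b ≤ pOsc p φ a b := by
  rcases hp'.eq_or_lt with rfl | hp'
  · rw [h.pOsc_two hab]; simp
  rcases hp.eq_or_lt with rfl | hp
  · refine (le_of_eq ?_).trans (h.osc2_div_le_pOsc_one hN hab)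
    rw [Real.Gamma_one, show (1 : ℝ) - 2 = -1 by norm_num, Real.rpow_neg_one]
    field_simp
  refine le_avg_of_le_lintegral hab (fun t => Real.rpow_nonneg (abs_nonneg _) _)
    (h.integrable_deviation_rpow hN hab (by linarith)) ?_
  refine le_trans (le_of_eq ?_) (le_lintegral_rpow_of_truncation (h.aemeasurable_deviation _)
    (fun _ => abs_nonneg _) hN (mul_nonneg (sub_pos.2 hab).le (h.nonneg le_rfl hab le_rfl))
    (h.lintegral_deviation_sq hab) (fun _ hs => h.lintegral_truncation_sub_avg_le hN hab hs)
    hp hp')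
  congr 1
  ring

lemma OscBoundedBy.le_pOsc_of_le_one (h : OscBoundedBy (N ^ 2) φ a b) (hN : 0 < N)
    (hab : a < b) {p : ℝ} (hp : 0 < p) (hp' : p ≤ 1) :
    (2 : ℝ) ^ (p - 2) * N ^ (p - 2) * osc2 φ a b ≤ pOsc p φ a b := by
  have h1 := h.osc2_div_le_pOsc_one hN hab
  have h2 := h.pOsc_two hab
  have i1 := h.integrable_deviation_rpow hN hab one_pos
  have i2 := h.integrable_deviation_rpow hN hab two_pos
  have ip := h.integrable_deviation_rpow hN hab hp
  -- The minorant is used at `u = |φ t - avg φ a b| / (2 * N)`. The first moment is at least `V / (2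
  -- * N)`, so the coefficients combine as `(2 - p) - (1 - p) = 1`.
  have hpt : ∀ t, (2 * N) ^ p * ((2 - p) / (2 * N)) * |φ t - avg φ a b| ^ (1 : ℝ) -
      (2 * N) ^ p * ((1 - p) / (2 * N) ^ 2) * |φ t - avg φ a b| ^ (2 : ℝ) ≤
        |φ t - avg φ a b| ^ p := by
    intro t
    have := rpow_ge_quadratic hp hp' (div_nonneg (abs_nonneg (φ t - avg φ a b))
      (by positivity : 0 ≤ 2 * N))
    rw [Real.div_rpow (abs_nonneg _) (by positivity), le_div_iff₀ (by positivity)] at this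
    rw [Real.rpow_one, Real.rpow_two]
    refine le_trans (le_of_eq ?_) this
    field_simp
  have j1 := i1.const_mul ((2 * N) ^ p * ((2 - p) / (2 * N)))
  have j2 := i2.const_mul ((2 * N) ^ p * ((1 - p) / (2 * N) ^ 2))
  have hav := avg_mono hab (j1.sub j2) ip hpt
  rw [avg_sub hab j1 j2, avg_const_mul _ (fun t => |φ t - avg φ a b| ^ (1 : ℝ)) hab.le,
    avg_const_mul _ (fun t => |φ t - avg φ a b| ^ (2 : ℝ)) hab.le] at hav
  change _ * pOsc 1 φ a b - _ * pOsc 2 φ a b ≤ pOsc p φ a b at hav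
  have e2 : (2 : ℝ) ^ (p - 2) * N ^ (p - 2) = (2 * N) ^ p / (2 * N) ^ 2 := by
    rw [← Real.mul_rpow (by norm_num) hN.le, Real.rpow_sub (by positivity), Real.rpow_two]
  refine le_trans ?_ hav
  have hP : 0 ≤ (2 * N) ^ p := by positivity
  have : (2 * N) ^ p * ((2 - p) / (2 * N)) * (osc2 φ a b / (2 * N)) ≤
      (2 * N) ^ p * ((2 - p) / (2 * N)) * pOsc 1 φ a b :=
    mul_le_mul_of_nonneg_left h1 (mul_nonneg hP (div_nonneg (by linarith) (by positivity)))
  rw [e2, h2]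
  refine le_trans (le_of_eq ?_) (sub_le_sub_right this _)
  field_simp
  ring

lemma sq_abs_rpow_half (x p : ℝ) : (|x| ^ 2) ^ (p / 2) = |x| ^ p := by
  rw [← Real.rpow_natCast, ← Real.rpow_mul (abs_nonneg _)]
  congr 1
  push_cast
  ring

lemma OscBoundedBy.osc2_eq_setAverage {κ : ℝ} (h : OscBoundedBy κ φ a b) (hab : a < b) :
    osc2 φ a b = ⨍ t in Ioo a b, |φ t - avg φ a b| ^ 2 := by
  rw [← h.pOsc_two hab]
  simp_rw [pOsc, Real.rpow_two]
  rfl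

/-- Jensen for the convex power `p / 2` of the squared deviation; for `p ≤ 2` the same power is
concave and the inequality reverses. -/
lemma OscBoundedBy.osc2_rpow_le_pOsc (h : OscBoundedBy (N ^ 2) φ a b) (hN : 0 < N)
    (hab : a < b) {p : ℝ} (hp : 2 ≤ p) : osc2 φ a b ^ (p / 2) ≤ pOsc p φ a b := by
  have hi := h.integrable_deviation_rpow hN hab (show 0 < p by linarith)
  rw [h.osc2_eq_setAverage hab]
  have := (convexOn_rpow (show 1 ≤ p / 2 by linarith)).map_set_average_le (μ := volume)
    (t := Ioo a b) (f := fun t => |φ t - avg φ a b| ^ 2)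
    (continuousOn_id.rpow_const fun x _ => Or.inr (by linarith)) isClosed_Ici
    (by simpa using hab) (by simp) (.of_forall fun t => sq_nonneg |φ t - avg φ a b|)
    (h.integrable_deviation_sq _) (by simpa only [Function.comp_def, sq_abs_rpow_half] using hi)
  simp only [sq_abs_rpow_half] at this
  exact this

lemma OscBoundedBy.pOsc_le_osc2_rpow (h : OscBoundedBy (N ^ 2) φ a b) (hN : 0 < N)
    (hab : a < b) {p : ℝ} (hp : 0 < p) (hp' : p ≤ 2) :
    pOsc p φ a b ≤ osc2 φ a b ^ (p / 2) := by
  have hi := h.integrable_deviation_rpow hN hab hp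
  rw [h.osc2_eq_setAverage hab]
  have := (Real.concaveOn_rpow (show 0 ≤ p / 2 by linarith)
    (show p / 2 ≤ 1 by linarith)).le_map_set_average (μ := volume)
    (t := Ioo a b) (f := fun t => |φ t - avg φ a b| ^ 2)
    (continuousOn_id.rpow_const fun x _ => Or.inr (by linarith)) isClosed_Ici
    (by simpa using hab) (by simp) (.of_forall fun t => sq_nonneg |φ t - avg φ a b|)
    (h.integrable_deviation_sq _) (by simpa only [Function.comp_def, sq_abs_rpow_half] using hi)
  simp only [sq_abs_rpow_half] at this
  exact this

end

/-! ### Reduction of the extremal functions to the unit interval. -/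

lemma avg_congr {f g : ℝ → ℝ} {c d : ℝ} (h : ∀ t ∈ Ioo c d, f t = g t) :
    avg f c d = avg g c d :=
  setAverage_congr_fun measurableSet_Ioo (.of_forall h)

lemma avg_const (k : ℝ) {c d : ℝ} (h : c < d) : avg (fun _ => k) c d = k := by
  rw [avg_eq_intervalIntegral _ h.le]
  have := sub_pos.2 h
  simp only [intervalIntegral.integral_const, smul_eq_mul]
  field_simp

lemma avg_eq_of_eqOn_const {f : ℝ → ℝ} {c d k : ℝ} (hcd : c < d) (h : ∀ t ∈ Ioo c d, f t = k) :
    avg f c d = k := (avg_congr h).trans (avg_const k hcd)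

lemma avg_comp_one_sub (f : ℝ → ℝ) {c d : ℝ} (h : c ≤ d) :
    avg (fun t => f (1 - t)) c d = avg f (1 - d) (1 - c) := by
  rw [avg_eq_intervalIntegral _ h, avg_eq_intervalIntegral _ (by linarith),
    intervalIntegral.integral_comp_sub_left]
  ring_nf

lemma avg_comp_affine (g : ℝ → ℝ) {a b c d : ℝ} (hab : a < b) (h : c ≤ d) :
    avg (fun t => g ((t - a) / (b - a))) c d = avg g ((c - a) / (b - a)) ((d - a) / (b - a)) := by
  have hL := sub_pos.2 hab
  rw [avg_eq_intervalIntegral _ h, avg_eq_intervalIntegral _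
    (div_le_div_of_nonneg_right (by linarith) hL.le),
    intervalIntegral.integral_comp_sub_right (fun t => g (t / (b - a))),
    intervalIntegral.integral_comp_div _ hL.ne', ← sub_div, inv_div, smul_eq_mul]
  rw [show d - a - (c - a) = d - c by ring]
  ring

lemma integrableOn_comp_affine {g : ℝ → ℝ} {a b : ℝ} (hab : a < b)
    (h : IntegrableOn g (Ioo 0 1)) :
    IntegrableOn (fun t => g ((t - a) / (b - a))) (Ioo a b) := by
  have hL := sub_pos.2 hab
  have h₁ : IntervalIntegrable g volume 0 1 :=
    (intervalIntegrable_iff_integrableOn_Ioo_of_le zero_le_one).2 h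
  have h₂ := (h₁.comp_mul_right (c := (b - a)⁻¹)).comp_sub_right a
  rw [zero_div, zero_add, one_div, inv_inv, sub_add_cancel] at h₂
  exact (intervalIntegrable_iff_integrableOn_Ioo_of_le hab.le).1 h₂

lemma osc2_comp_affine (g : ℝ → ℝ) {a b c d : ℝ} (hab : a < b) (h : c ≤ d) :
    osc2 (fun t => g ((t - a) / (b - a))) c d =
      osc2 g ((c - a) / (b - a)) ((d - a) / (b - a)) := by
  rw [osc2, osc2, avg_comp_affine g hab h, avg_comp_affine (fun t => g t ^ 2) hab h]

/-- A function on `(0, 1)` whose `2`-oscillations are at most `ε²`, with equality on `(0, 1)`,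
yields by an affine change of variable a function of norm `ε` on any interval. -/
lemma OscBoundedBy.comp_affine {g : ℝ → ℝ} {ε a b : ℝ} (h : OscBoundedBy (ε ^ 2) g 0 1)
    (hε : 0 < ε) (he : osc2 g 0 1 = ε ^ 2) (hab : a < b) :
    MemBMO (fun t => g ((t - a) / (b - a))) a b ∧
      bmoNorm (fun t => g ((t - a) / (b - a))) a b = ε ∧
      osc2 (fun t => g ((t - a) / (b - a))) a b = ε ^ 2 ∧
      ∀ p, pOsc p (fun t => g ((t - a) / (b - a))) a b = pOsc p g 0 1 := by
  have hL := sub_pos.2 hab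
  have ea : (a - a) / (b - a) = 0 := by simp
  have eb : (b - a) / (b - a) = 1 := div_self hL.ne'
  have hle : ∀ c d : ℝ, a ≤ c → c < d → d ≤ b →
      osc2 (fun t => g ((t - a) / (b - a))) c d ≤ ε ^ 2 := by
    intro c d h₁ h₂ h₃
    rw [osc2_comp_affine g hab h₂.le]
    refine h.osc2_le _ _ (div_nonneg (by linarith) hL.le)
      (div_lt_div_of_pos_right (by linarith) hL) ?_
    rw [div_le_one hL]
    linarith
  have hQ : osc2 (fun t => g ((t - a) / (b - a))) a b = ε ^ 2 := by
    rw [osc2_comp_affine g hab hab.le, ea, eb, he]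
  refine ⟨⟨integrableOn_comp_affine hab h.integrable, ε, fun c d h₁ h₂ h₃ =>
    ⟨(integrableOn_comp_affine (g := fun t => g t ^ 2) hab h.integrable_sq).mono_set
      (Ioo_subset_Ioo h₁ h₃), hle c d h₁ h₂ h₃⟩⟩, ?_, hQ, fun p => ?_⟩
  · refine IsGreatest.csSup_eq ⟨⟨a, b, le_rfl, hab, le_rfl, ?_⟩, ?_⟩
    · rw [hQ, Real.sqrt_sq hε.le]
    · rintro r ⟨c, d, h₁, h₂, h₃, rfl⟩
      exact Real.sqrt_le_iff.2 ⟨hε.le, hle c d h₁ h₂ h₃⟩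
  · rw [pOsc, pOsc, avg_comp_affine g hab hab.le, ea, eb,
      avg_comp_affine (fun t => |g t - avg g 0 1| ^ p) hab hab.le, ea, eb]

lemma integrableOn_Ioo_of_bounded {f : ℝ → ℝ} {a b C : ℝ} (hf : Measurable f)
    (h : ∀ t, |f t| ≤ C) : IntegrableOn f (Ioo a b) :=
  Integrable.mono' (g := fun _ => C) (by simp) hf.aestronglyMeasurable (.of_forall h)

lemma avg_split_symm {f : ℝ → ℝ} {c d δ : ℝ} (hδ : δ < 1 / 2) (hc : c < δ) (hd : 1 - δ < d)
    (hf : IntegrableOn f (Ioo c d)) :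
    (d - c) * avg f c d = (δ - c) * avg f c δ + (1 - 2 * δ) * avg f δ (1 - δ) +
      (d - (1 - δ)) * avg f (1 - δ) d := by
  have h₁ : δ < d := by linarith
  have hL : d - c ≠ 0 := by linarith
  have hL' : d - δ ≠ 0 := by linarith
  rw [avg_split hf hc h₁, avg_split (hf.mono_set (Ioo_subset_Ioo_left hc.le))
    (by linarith : δ < 1 - δ) hd]
  field_simp
  ring

/-! ### The extremal step functions. -/

lemma twoStep_eq (ε a b : ℝ) :
    twoStep ε a b = fun t => twoStep ε 0 1 ((t - a) / (b - a)) := by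
  funext t
  simp [twoStep]

lemma threeStep_eq (ε a b : ℝ) :
    threeStep ε a b = fun t => threeStep ε 0 1 ((t - a) / (b - a)) := by
  funext t
  simp [threeStep]

lemma doubleLog_eq (ε a b : ℝ) :
    doubleLog ε a b = fun t => doubleLog ε 0 1 ((t - a) / (b - a)) := by
  funext t
  simp [doubleLog]

lemma measurable_twoStep (ε a b : ℝ) : Measurable (twoStep ε a b) :=
  Measurable.ite (measurableSet_lt (by fun_prop) measurable_const) measurable_const
    measurable_const

lemma measurable_threeStep (ε a b : ℝ) : Measurable (threeStep ε a b) :=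
  Measurable.ite (measurableSet_lt (by fun_prop) measurable_const) measurable_const
    (Measurable.ite (measurableSet_le (by fun_prop) measurable_const) measurable_const
      measurable_const)

lemma measurable_doubleLog (ε a b : ℝ) : Measurable (doubleLog ε a b) :=
  Measurable.ite (measurableSet_lt (by fun_prop) measurable_const) (by fun_prop)
    (Measurable.ite (measurableSet_le (by fun_prop) measurable_const) measurable_const
      (by fun_prop))

lemma abs_twoStep {ε : ℝ} (hε : 0 < ε) (a b t : ℝ) : |twoStep ε a b t| = ε := by
  rw [twoStep]
  split_ifs <;> simp [abs_of_pos hε]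

lemma avg_twoStep (ε : ℝ) : avg (twoStep ε 0 1) 0 1 = 0 := by
  have hi : IntegrableOn (twoStep ε 0 1) (Ioo 0 1) := by
    refine integrableOn_Ioo_of_bounded (C := |ε|) (measurable_twoStep _ _ _) fun t => ?_
    rw [twoStep]
    split_ifs <;> simp
  have h₁ : avg (twoStep ε 0 1) 0 (1 / 2) = -ε :=
    avg_eq_of_eqOn_const (by norm_num) fun t ht => by
      simp only [twoStep, sub_zero, div_one]
      rw [if_pos ht.2]
  have h₂ : avg (twoStep ε 0 1) (1 / 2) 1 = ε :=
    avg_eq_of_eqOn_const (by norm_num) fun t ht => by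
      simp only [twoStep, sub_zero, div_one]
      rw [if_neg (by linarith [ht.1])]
  rw [avg_split hi (show (0 : ℝ) < 1 / 2 by norm_num) (by norm_num), h₁, h₂]
  norm_num

lemma twoStep_sq {ε : ℝ} (hε : 0 < ε) (a b : ℝ) :
    (fun t => twoStep ε a b t ^ 2) = fun _ => ε ^ 2 := by
  funext t
  rw [← sq_abs, abs_twoStep hε]

lemma osc2_twoStep {ε : ℝ} (hε : 0 < ε) : osc2 (twoStep ε 0 1) 0 1 = ε ^ 2 := by
  rw [osc2, twoStep_sq hε, avg_const _ one_pos, avg_twoStep]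
  ring

lemma oscBoundedBy_twoStep {ε : ℝ} (hε : 0 < ε) : OscBoundedBy (ε ^ 2) (twoStep ε 0 1) 0 1 where
  integrable := integrableOn_Ioo_of_bounded (measurable_twoStep _ _ _)
    fun t => (abs_twoStep hε 0 1 t).le
  integrable_sq := by
    rw [twoStep_sq hε]
    simp
  osc2_le c d _ h _ := by
    rw [osc2, twoStep_sq hε, avg_const _ h]
    linarith [sq_nonneg (avg (twoStep ε 0 1) c d)]

lemma pOsc_twoStep {ε : ℝ} (hε : 0 < ε) (p : ℝ) : pOsc p (twoStep ε 0 1) 0 1 = ε ^ p := by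
  simp_rw [pOsc, avg_twoStep, sub_zero, abs_twoStep hε]
  exact avg_const _ one_pos

lemma threeStep_of_lt {ε t : ℝ} (h : t < 1 / 8) : threeStep ε 0 1 t = -(2 * ε) := by
  simp only [threeStep, sub_zero, div_one]
  rw [if_pos h]

lemma threeStep_of_mem {ε t : ℝ} (h : 1 / 8 ≤ t) (h' : t ≤ 7 / 8) : threeStep ε 0 1 t = 0 := by
  simp only [threeStep, sub_zero, div_one]
  rw [if_neg (not_lt.2 h), if_pos h']

lemma threeStep_of_gt {ε t : ℝ} (h : 7 / 8 < t) : threeStep ε 0 1 t = 2 * ε := by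
  simp only [threeStep, sub_zero, div_one]
  rw [if_neg (by linarith), if_neg (not_le.2 h)]

lemma avg_comp_threeStep (ε : ℝ) (F : ℝ → ℝ) (hF : Measurable F) {c d : ℝ} (hc : c < 1 / 8)
    (hd : 7 / 8 < d) :
    IntegrableOn (fun t => F (threeStep ε 0 1 t)) (Ioo c d) ∧
    (d - c) * avg (fun t => F (threeStep ε 0 1 t)) c d =
      (1 / 8 - c) * F (-(2 * ε)) + 3 / 4 * F 0 + (d - 7 / 8) * F (2 * ε) := by
  have hi : IntegrableOn (fun t => F (threeStep ε 0 1 t)) (Ioo c d) := by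
    refine integrableOn_Ioo_of_bounded (C := |F (-(2 * ε))| + |F 0| + |F (2 * ε)|)
      (hF.comp (measurable_threeStep _ _ _)) fun t => ?_
    have := abs_nonneg (F (-(2 * ε)))
    have := abs_nonneg (F 0)
    have := abs_nonneg (F (2 * ε))
    rw [threeStep]
    split_ifs <;> linarith
  refine ⟨hi, ?_⟩
  have e : (1 : ℝ) - 1 / 8 = 7 / 8 := by norm_num
  rw [avg_split_symm (δ := 1 / 8) (by norm_num) hc (by linarith) hi, e,
    avg_eq_of_eqOn_const hc fun t ht => by rw [threeStep_of_lt ht.2],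
    avg_eq_of_eqOn_const (by norm_num) fun t ht => by rw [threeStep_of_mem ht.1.le ht.2.le],
    avg_eq_of_eqOn_const hd fun t ht => by rw [threeStep_of_gt ht.1]]
  ring

lemma avg_threeStep (ε : ℝ) : avg (threeStep ε 0 1) 0 1 = 0 := by
  have := (avg_comp_threeStep ε id measurable_id (c := 0) (d := 1) (by norm_num)
    (by norm_num)).2
  simp only [id] at this
  linarith

lemma osc2_threeStep (ε : ℝ) : osc2 (threeStep ε 0 1) 0 1 = ε ^ 2 := by
  have := (avg_comp_threeStep ε (fun x => x ^ 2) (by fun_prop) (c := 0) (d := 1) (by norm_num)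
    (by norm_num)).2
  rw [osc2, avg_threeStep]
  linarith

lemma pOsc_threeStep {ε p : ℝ} (hε : 0 < ε) (hp : 0 < p) :
    pOsc p (threeStep ε 0 1) 0 1 = (2 * ε) ^ p / 4 := by
  have := (avg_comp_threeStep ε (fun x => |x - 0| ^ p) (by fun_prop) (c := 0) (d := 1)
    (by norm_num) (by norm_num)).2
  rw [pOsc, avg_threeStep]
  simp only [sub_zero, abs_neg, abs_zero, Real.zero_rpow hp.ne', abs_of_pos (by positivity : 0 < 2 * ε)] at this ⊢
  linarith

lemma oscBoundedBy_threeStep (ε : ℝ) : OscBoundedBy (ε ^ 2) (threeStep ε 0 1) 0 1 := by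
  have i₁ : IntegrableOn (threeStep ε 0 1) (Ioo 0 1) :=
    (avg_comp_threeStep ε id measurable_id (by norm_num) (by norm_num)).1
  have i₂ : IntegrableOn (fun t => threeStep ε 0 1 t ^ 2) (Ioo 0 1) :=
    (avg_comp_threeStep ε (fun x => x ^ 2) (by fun_prop) (by norm_num) (by norm_num)).1
  refine ⟨i₁, i₂, fun c d h₀ h h₁ => ?_⟩
  have hbound := osc2_le_avg_sub_const_sq h (i₁.mono_set (Ioo_subset_Ioo h₀ h₁))
    (i₂.mono_set (Ioo_subset_Ioo h₀ h₁))
  rcases le_or_gt d (7 / 8) with hd | hd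
  -- Missing the upper step, the function takes only the values `-2 * ε` and `0`, both at distance
  -- `ε` from `-ε`.
  · refine (hbound (-ε)).trans (le_of_eq (avg_eq_of_eqOn_const h fun t ht => ?_))
    rcases lt_or_ge t (1 / 8) with h8 | h8
    · rw [threeStep_of_lt h8]; ring
    · rw [threeStep_of_mem h8 (ht.2.le.trans hd)]; ring
  rcases le_or_gt (1 / 8) c with hc | hc
  · refine (hbound ε).trans (le_of_eq (avg_eq_of_eqOn_const h fun t ht => ?_))
    rcases le_or_gt t (7 / 8) with h8 | h8
    · rw [threeStep_of_mem (hc.trans ht.1.le) h8]; ring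
    · rw [threeStep_of_gt h8]; ring
  -- Here the interval contains the whole zero plateau, so the integral of the square is `4 * ε² *
  -- (L - 3 / 4)` with `L = d - c`, and this is at most `ε² * L` because `L ≤ 1`.
  have h₂ := (avg_comp_threeStep ε (fun x => (x - 0) ^ 2) (by fun_prop) hc hd).2
  refine (hbound 0).trans (le_of_mul_le_mul_left ?_ (sub_pos.2 h))
  rw [h₂]
  nlinarith [sq_nonneg ε]

/-! ### The double logarithm. -/

lemma image_exp_neg_div_four : (fun x : ℝ => Real.exp (-x) / 4) '' Ioi 0 = Ioo 0 (1 / 4) := by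
  ext s
  constructor
  · rintro ⟨x, hx, rfl⟩
    have : Real.exp (-x) < 1 := by simpa using hx
    exact ⟨by positivity, by linarith⟩
  · rintro ⟨h₁, h₂⟩
    refine ⟨-Real.log (4 * s), ?_, ?_⟩
    · have := Real.log_neg (show 0 < 4 * s by linarith) (by linarith)
      simpa using this
    · simp only [neg_neg]
      rw [Real.exp_log (by linarith)]
      ring

/-- The substitution `s = exp (-x) / 4` turns the integral into Euler's integral for the Gamma
function. -/
lemma abs_log_rpow_integral {p : ℝ} (hp : 0 < p) :
    IntegrableOn (fun s => |Real.log (4 * s)| ^ p) (Ioo 0 (1 / 4)) ∧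
      ∫ s in Ioo (0 : ℝ) (1 / 4), |Real.log (4 * s)| ^ p = Real.Gamma (p + 1) / 4 := by
  have hd : ∀ x ∈ Ioi (0 : ℝ), HasDerivWithinAt (fun x : ℝ => Real.exp (-x) / 4)
      (-(Real.exp (-x) / 4)) (Ioi 0) x := fun x _ => by
    refine (((hasDerivAt_neg x).exp.div_const 4).congr_deriv ?_).hasDerivWithinAt
    ring
  have hinj : InjOn (fun x : ℝ => Real.exp (-x) / 4) (Ioi 0) := by
    intro x _ y _ h
    have h' : Real.exp (-x) / 4 = Real.exp (-y) / 4 := h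
    have := Real.exp_injective (show Real.exp (-x) = Real.exp (-y) by linarith)
    linarith
  have he : ∀ x ∈ Ioi (0 : ℝ), |-(Real.exp (-x) / 4)| • |Real.log (4 * (Real.exp (-x) / 4))| ^ p =
      1 / 4 * (Real.exp (-x) * x ^ (p + 1 - 1)) := by
    intro x hx
    rw [mul_div_cancel₀ _ (by norm_num : (4 : ℝ) ≠ 0), Real.log_exp, abs_neg, abs_neg,
      abs_of_pos (show 0 < x from hx), abs_of_pos (by positivity), add_sub_cancel_right, smul_eq_mul]
    ring
  have hG := Real.GammaIntegral_convergent (show 0 < p + 1 by linarith)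
  constructor
  · rw [← image_exp_neg_div_four,
      integrableOn_image_iff_integrableOn_abs_deriv_smul measurableSet_Ioi hd hinj,
      integrableOn_congr_fun he measurableSet_Ioi]
    exact hG.const_mul _
  · rw [← image_exp_neg_div_four,
      integral_image_eq_integral_abs_deriv_smul measurableSet_Ioi hd hinj,
      setIntegral_congr_fun measurableSet_Ioi he, integral_const_mul,
      Real.Gamma_eq_integral (by linarith)]
    ring

lemma continuous_mul_log_sq : ContinuousOn (fun t : ℝ => t * Real.log t ^ 2) (Ici 0) := by
  have h : Continuous fun t : ℝ => 4 * (√t * Real.log √t) ^ 2 :=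
    ((Real.continuous_mul_log.comp Real.continuous_sqrt).pow 2).const_mul 4
  refine h.continuousOn.congr fun t ht => ?_
  simp only
  rw [Real.log_sqrt ht, mul_pow, Real.sq_sqrt ht]
  ring

lemma intervalIntegrable_log_sq {c d : ℝ} (hc : 0 ≤ c) (hcd : c ≤ d) (hd : d ≤ 1 / 4) :
    IntervalIntegrable (fun t => Real.log t ^ 2) volume c d := by
  rw [intervalIntegrable_iff_integrableOn_Ioo_of_le hcd]
  have h₁ : IntegrableOn (fun t => |Real.log (4 * t)| ^ (2 : ℝ)) (Ioo c d) :=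
    (abs_log_rpow_integral two_pos).1.mono_set (Ioo_subset_Ioo hc hd)
  have h₂ : IntegrableOn Real.log (Ioo c d) :=
    (intervalIntegrable_iff_integrableOn_Ioo_of_le hcd).1 intervalIntegral.intervalIntegrable_log'
  have h₃ : IntegrableOn (fun t => |Real.log (4 * t)| ^ (2 : ℝ) - 2 * Real.log 4 * Real.log t -
      Real.log 4 ^ 2) (Ioo c d) := (h₁.sub (h₂.const_mul _)).sub (by simp)
  refine h₃.congr_fun (fun t ht => ?_) measurableSet_Ioo
  simp only
  rw [Real.rpow_two, sq_abs, Real.log_mul (by norm_num) (hc.trans_lt ht.1).ne']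
  ring

/-- The antiderivative `t * ((log t - l)² + 1 + n)` has derivative `(log t - l + 1)² + n`, whence `m
= l - 1`. It extends continuously to `t = 0`, so `c = 0` is allowed. -/
lemma integral_log_sub_sq {c d : ℝ} (hc : 0 ≤ c) (hcd : c ≤ d) (hd : d ≤ 1 / 4) (l m n : ℝ)
    (hm : m = l - 1) :
    ∫ t in c..d, ((Real.log t - m) ^ 2 + n) =
      d * ((Real.log d - l) ^ 2 + 1 + n) - c * ((Real.log c - l) ^ 2 + 1 + n) := by
  have hi : IntervalIntegrable (fun t => (Real.log t - m) ^ 2 + n) volume c d := by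
    have h₁ := ((intervalIntegrable_log_sq hc hcd hd).sub
      ((intervalIntegral.intervalIntegrable_log' (a := c) (b := d)).const_mul (2 * m))).add
      (intervalIntegrable_const (c := m ^ 2 + n))
    refine h₁.congr (fun t _ => ?_)
    ring
  refine intervalIntegral.integral_eq_sub_of_hasDerivAt_of_le hcd
    (f := fun t => t * ((Real.log t - l) ^ 2 + 1 + n)) ?_ ?_ hi
  · have h₁ : ContinuousOn (fun t => t * Real.log t ^ 2 - 2 * l * (t * Real.log t) +
        (l ^ 2 + 1 + n) * t) (Icc c d) := by
      refine ((continuous_mul_log_sq.mono fun t ht => hc.trans ht.1).sub ?_).add (by fun_prop)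
      exact (Real.continuous_mul_log.const_mul _).continuousOn
    refine h₁.congr fun t _ => ?_
    ring
  · intro t ht
    have ht0 : t ≠ 0 := (hc.trans_lt ht.1).ne'
    have h₁ := (((Real.hasDerivAt_log ht0).sub_const l).pow 2).add_const (1 + n)
    refine ((hasDerivAt_id t).mul h₁).congr_deriv ?_ |>.congr_of_eventuallyEq
      (.of_forall fun x => ?_)
    · rw [hm]
      simp
      field_simp
      ring
    · simp [add_assoc]

lemma integral_log_ratio_add_one_sq_le {c d : ℝ} (hc : 0 ≤ c) (hcd : c < d) (hd : d ≤ 1 / 4) :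
    ∫ t in c..d, (Real.log t - (Real.log d - 1)) ^ 2 ≤ d - c := by
  have := integral_log_sub_sq hc hcd.le hd (Real.log d) (Real.log d - 1) 0 rfl
  simp only [add_zero, sub_self] at this
  rw [this]
  nlinarith [mul_nonneg hc (sq_nonneg (Real.log c - Real.log d))]

lemma integral_log_ratio_sq_le {c d : ℝ} (hc : 0 ≤ c) (hcd : c < d) (hd : d ≤ 1 / 4) :
    ∫ t in c..d, (Real.log t - Real.log d) ^ 2 ≤ 2 * (d - c) := by
  have := integral_log_sub_sq hc hcd.le hd (Real.log d + 1) (Real.log d) 0 (by ring)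
  simp only [add_zero] at this
  rw [this]
  -- At `c = 0` the convention `Real.log 0 = 0` breaks monotonicity of the logarithm, but the factor
  -- `c` removes that term.
  rcases hc.eq_or_lt with rfl | hc
  · nlinarith
  · have : Real.log c ≤ Real.log d := Real.log_le_log hc hcd.le
    nlinarith [mul_nonneg hc.le (sub_nonneg.2 this),
      mul_nonneg hc.le (sq_nonneg (Real.log c - Real.log d))]

lemma doubleLog_eq_mul (ε t : ℝ) : doubleLog ε 0 1 t = ε * (doubleLog 1 0 1 t - 0) := by
  simp only [doubleLog]
  split_ifs <;> ring

lemma doubleLog_of_lt {t : ℝ} (h : t < 1 / 4) : doubleLog 1 0 1 t = Real.log (4 * t) := by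
  simp only [doubleLog, sub_zero, div_one, one_mul]
  rw [if_pos h]

lemma doubleLog_of_mem {t : ℝ} (h : 1 / 4 ≤ t) (h' : t ≤ 3 / 4) : doubleLog 1 0 1 t = 0 := by
  simp only [doubleLog, sub_zero, div_one]
  rw [if_neg (not_lt.2 h), if_pos h']

lemma doubleLog_one_sub (t : ℝ) : doubleLog 1 0 1 (1 - t) = -doubleLog 1 0 1 t := by
  simp only [doubleLog, sub_zero, div_one, one_mul]
  rcases lt_or_ge t (1 / 4) with h | h
  · rw [if_neg (by linarith), if_neg (by linarith), if_pos h]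
    ring_nf
  rcases le_or_gt t (3 / 4) with h' | h'
  · rw [if_neg (by linarith), if_pos (by linarith), if_neg (by linarith), if_pos h', neg_zero]
  · rw [if_pos (by linarith), if_neg (by linarith), if_neg (by linarith)]
    ring_nf

lemma integrableOn_abs_doubleLog_rpow {p : ℝ} (hp : 0 < p) :
    IntegrableOn (fun t => |doubleLog 1 0 1 t| ^ p) (Ioo 0 1) := by
  have h₁ : IntegrableOn (fun t => |doubleLog 1 0 1 t| ^ p) (Ioo 0 (1 / 4)) :=
    (abs_log_rpow_integral hp).1.congr_fun (fun t ht => by simp only [doubleLog_of_lt ht.2])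
      measurableSet_Ioo
  have h₂ : IntegrableOn (fun t => |doubleLog 1 0 1 t| ^ p) (Ioo (1 / 4) (3 / 4)) := by
    have : IntegrableOn (fun _ : ℝ => (0 : ℝ)) (Ioo (1 / 4) (3 / 4)) := by simp
    refine this.congr_fun (fun t ht => ?_) measurableSet_Ioo
    simp only [doubleLog_of_mem ht.1.le ht.2.le, abs_zero, Real.zero_rpow hp.ne']
  have j₁ := (intervalIntegrable_iff_integrableOn_Ioo_of_le (by norm_num)).2 h₁
  have j₂ := (intervalIntegrable_iff_integrableOn_Ioo_of_le (by norm_num)).2 h₂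
  have j₃ := (j₁.comp_sub_left 1).symm
  simp only [doubleLog_one_sub, abs_neg] at j₃
  rw [sub_zero, show (1 : ℝ) - 1 / 4 = 3 / 4 by norm_num] at j₃
  exact (intervalIntegrable_iff_integrableOn_Ioo_of_le zero_le_one).1 ((j₁.trans j₂).trans j₃)

lemma integrableOn_doubleLog_sq :
    IntegrableOn (fun t => doubleLog 1 0 1 t ^ 2) (Ioo 0 1) := by
  simpa only [Real.rpow_two, sq_abs] using integrableOn_abs_doubleLog_rpow two_pos

lemma integrableOn_doubleLog : IntegrableOn (doubleLog 1 0 1) (Ioo 0 1) := by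
  have := integrableOn_abs_doubleLog_rpow one_pos
  simp only [Real.rpow_one] at this
  exact (integrable_norm_iff (measurable_doubleLog 1 0 1).aestronglyMeasurable).1 this

lemma avg_doubleLog : avg (doubleLog 1 0 1) 0 1 = 0 := by
  have h := avg_comp_one_sub (doubleLog 1 0 1) zero_le_one
  simp_rw [doubleLog_one_sub, neg_eq_neg_one_mul (doubleLog 1 0 1 _)] at h
  rw [avg_const_mul _ _ zero_le_one, sub_self, sub_zero] at h
  linarith

lemma avg_abs_doubleLog_rpow {p : ℝ} (hp : 0 < p) :
    avg (fun t => |doubleLog 1 0 1 t| ^ p) 0 1 = Real.Gamma (p + 1) / 2 := by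
  have h := avg_split_symm (δ := 1 / 4) (by norm_num) (by norm_num) (by norm_num)
    (integrableOn_abs_doubleLog_rpow hp)
  have h₁ : avg (fun t => |doubleLog 1 0 1 t| ^ p) 0 (1 / 4) = Real.Gamma (p + 1) := by
    rw [avg_congr (g := fun t => |Real.log (4 * t)| ^ p)
      fun t ht => by simp only [doubleLog_of_lt ht.2], avg_eq_setIntegral _ (by norm_num),
      (abs_log_rpow_integral hp).2]
    ring
  have h₂ : avg (fun t => |doubleLog 1 0 1 t| ^ p) (1 / 4) (1 - 1 / 4) = 0 :=
    avg_eq_of_eqOn_const (by norm_num) fun t ht => by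
      rw [doubleLog_of_mem ht.1.le (by linarith [ht.2]), abs_zero, Real.zero_rpow hp.ne']
  have h₃ : avg (fun t => |doubleLog 1 0 1 t| ^ p) (1 - 1 / 4) 1 = Real.Gamma (p + 1) := by
    have := avg_comp_one_sub (fun t => |doubleLog 1 0 1 t| ^ p)
      (show (0 : ℝ) ≤ 1 / 4 by norm_num)
    simp_rw [doubleLog_one_sub, abs_neg] at this
    rw [← h₁, this, sub_zero]
  rw [h₁, h₂, h₃] at h
  linarith

lemma osc2_doubleLog_one : osc2 (doubleLog 1 0 1) 0 1 = 1 := by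
  have := avg_abs_doubleLog_rpow two_pos
  simp only [Real.rpow_two, sq_abs] at this
  rw [osc2, avg_doubleLog, this, Real.Gamma_add_one two_ne_zero, Real.Gamma_two]
  norm_num

lemma avg_doubleLog_sub_sq_le {c d : ℝ} (hc : 0 ≤ c) (hcd : c < d) (hd : d ≤ 1 / 4) :
    avg (fun t => (doubleLog 1 0 1 t - (Real.log (4 * d) - 1)) ^ 2) c d ≤ 1 := by
  rw [avg_congr (g := fun t => (Real.log t - (Real.log d - 1)) ^ 2) fun t ht => ?_,
    avg_eq_intervalIntegral _ hcd.le, inv_mul_le_one₀ (sub_pos.2 hcd)]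
  · exact integral_log_ratio_add_one_sq_le hc hcd hd
  · have ht0 := hc.trans_lt ht.1
    rw [doubleLog_of_lt (ht.2.trans_le hd), Real.log_mul (by norm_num) ht0.ne',
      Real.log_mul (by norm_num) (ht0.trans ht.2).ne']
    ring

lemma avg_doubleLog_sq_le {c : ℝ} (hc : 0 ≤ c) (hc' : c < 1 / 4) :
    avg (fun t => doubleLog 1 0 1 t ^ 2) c (1 / 4) ≤ 2 := by
  rw [avg_congr (g := fun t => (Real.log t - Real.log (1 / 4)) ^ 2) fun t ht => ?_,
    avg_eq_intervalIntegral _ hc'.le, inv_mul_le_iff₀ (sub_pos.2 hc'), mul_comm]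
  · exact integral_log_ratio_sq_le hc hc' le_rfl
  · have ht0 := hc.trans_lt ht.1
    rw [doubleLog_of_lt ht.2, Real.log_mul (by norm_num) ht0.ne', one_div, Real.log_inv]
    ring

lemma osc2_doubleLog_le_of_le {c d : ℝ} (hc : 0 ≤ c) (hcd : c < d) (hd : d ≤ 3 / 4) :
    osc2 (doubleLog 1 0 1) c d ≤ 1 := by
  have i₁ : IntegrableOn (doubleLog 1 0 1) (Ioo c d) :=
    integrableOn_doubleLog.mono_set (Ioo_subset_Ioo hc (by linarith))
  have i₂ : IntegrableOn (fun t => doubleLog 1 0 1 t ^ 2) (Ioo c d) :=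
    integrableOn_doubleLog_sq.mono_set (Ioo_subset_Ioo hc (by linarith))
  have hbound := osc2_le_avg_sub_const_sq hcd i₁ i₂
  rcases le_or_gt d (1 / 4) with h | h
  · exact (hbound _).trans (avg_doubleLog_sub_sq_le hc hcd h)
  rcases le_or_gt (1 / 4) c with h' | h'
  · refine (hbound 1).trans (le_of_eq (avg_eq_of_eqOn_const hcd fun t ht => ?_))
    rw [doubleLog_of_mem (h'.trans ht.1.le) (ht.2.le.trans hd)]
    norm_num
  have i₃ : IntegrableOn (fun t => (doubleLog 1 0 1 t - (-1)) ^ 2) (Ioo c d) := by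
    have : IntegrableOn (fun t => doubleLog 1 0 1 t ^ 2 + 2 * doubleLog 1 0 1 t + 1)
      (Ioo c d) := (i₂.add (i₁.const_mul 2)).add (by simp)
    refine this.congr_fun (fun t _ => ?_) measurableSet_Ioo
    ring
  -- The constant `-1` is `log (4 * d) - 1` at `d = 1 / 4` and lies at distance `1` from the plateau
  -- value `0`, so it serves both pieces.
  refine (hbound (-1)).trans ?_
  have h₁ := avg_doubleLog_sub_sq_le hc h' le_rfl
  rw [show (4 : ℝ) * (1 / 4) = 1 by norm_num, Real.log_one, zero_sub] at h₁
  have h₂ : avg (fun t => (doubleLog 1 0 1 t - (-1)) ^ 2) (1 / 4) d = 1 :=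
    avg_eq_of_eqOn_const h fun t ht => by
      rw [doubleLog_of_mem ht.1.le (ht.2.le.trans hd)]
      norm_num
  have hL := sub_pos.2 hcd
  rw [avg_split i₃ h' h, h₂]
  have h₃ := mul_le_mul_of_nonneg_left h₁ (div_nonneg (sub_pos.2 h').le hL.le)
  refine (add_le_add_left h₃ _).trans (le_of_eq ?_)
  field_simp
  ring

lemma osc2_doubleLog_one_sub {c d : ℝ} (h : c ≤ d) :
    osc2 (doubleLog 1 0 1) (1 - d) (1 - c) = osc2 (doubleLog 1 0 1) c d := by
  rw [osc2, osc2, ← avg_comp_one_sub (doubleLog 1 0 1) h,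
    ← avg_comp_one_sub (fun t => doubleLog 1 0 1 t ^ 2) h]
  simp_rw [doubleLog_one_sub, neg_sq, neg_eq_neg_one_mul (doubleLog 1 0 1 _)]
  rw [avg_const_mul _ _ h]
  ring

lemma osc2_doubleLog_le {c d : ℝ} (hc : 0 ≤ c) (hcd : c < d) (hd : d ≤ 1) :
    osc2 (doubleLog 1 0 1) c d ≤ 1 := by
  rcases le_or_gt d (3 / 4) with h | h
  · exact osc2_doubleLog_le_of_le hc hcd h
  rcases le_or_gt (1 / 4) c with h' | h'
  · rw [← osc2_doubleLog_one_sub hcd.le]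
    exact osc2_doubleLog_le_of_le (by linarith) (by linarith) (by linarith)
  have i₂ : IntegrableOn (fun t => doubleLog 1 0 1 t ^ 2) (Ioo c d) :=
    integrableOn_doubleLog_sq.mono_set (Ioo_subset_Ioo hc hd)
  have hs := avg_split_symm (δ := 1 / 4) (by norm_num) h' (by linarith) i₂
  have h₁ := avg_doubleLog_sq_le hc h'
  have h₂ : avg (fun t => doubleLog 1 0 1 t ^ 2) (1 / 4) (1 - 1 / 4) = 0 :=
    avg_eq_of_eqOn_const (by norm_num) fun t ht => by
      rw [doubleLog_of_mem ht.1.le (by linarith [ht.2])]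
      norm_num
  have h₃ : avg (fun t => doubleLog 1 0 1 t ^ 2) (1 - 1 / 4) d ≤ 2 := by
    have := avg_comp_one_sub (fun t => doubleLog 1 0 1 t ^ 2) (show 1 - d ≤ 1 / 4 by linarith)
    simp_rw [doubleLog_one_sub, neg_sq] at this
    rw [sub_sub_cancel] at this
    rw [← this]
    exact avg_doubleLog_sq_le (by linarith) (by linarith)
  -- The two logarithmic ends have total length `L - 1 / 2`, with `L = d - c`, and mean square at
  -- most `2`; `2 * (L - 1 / 2) ≤ L` because `L ≤ 1`.
  have hle : avg (fun t => doubleLog 1 0 1 t ^ 2) c d ≤ 1 := by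
    refine le_of_mul_le_mul_left ?_ (sub_pos.2 hcd)
    rw [hs, h₂]
    nlinarith
  rw [osc2]
  linarith [sq_nonneg (avg (doubleLog 1 0 1) c d)]

lemma oscBoundedBy_doubleLog (ε : ℝ) : OscBoundedBy (ε ^ 2) (doubleLog ε 0 1) 0 1 := by
  have h : OscBoundedBy 1 (doubleLog 1 0 1) 0 1 :=
    ⟨integrableOn_doubleLog, integrableOn_doubleLog_sq, fun _ _ h₁ h₂ h₃ =>
      osc2_doubleLog_le h₁ h₂ h₃⟩
  have := h.const_mul_sub ε 0
  simp_rw [← doubleLog_eq_mul] at this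
  rwa [mul_one] at this

lemma osc2_doubleLog (ε : ℝ) : osc2 (doubleLog ε 0 1) 0 1 = ε ^ 2 := by
  have := osc2_mul_sub one_pos integrableOn_doubleLog integrableOn_doubleLog_sq ε 0
  simp_rw [← doubleLog_eq_mul] at this
  rw [this, osc2_doubleLog_one, mul_one]

lemma pOsc_doubleLog {ε p : ℝ} (hε : 0 < ε) (hp : 0 < p) :
    pOsc p (doubleLog ε 0 1) 0 1 = ε ^ p * (p / 2 * Real.Gamma p) := by
  have h₁ : doubleLog ε 0 1 = fun t => ε * doubleLog 1 0 1 t := by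
    funext t
    rw [doubleLog_eq_mul, sub_zero]
  rw [pOsc, h₁, avg_const_mul _ _ zero_le_one, avg_doubleLog]
  simp_rw [mul_zero, sub_zero, abs_mul, abs_of_pos hε, Real.mul_rpow hε.le (abs_nonneg _)]
  rw [avg_const_mul _ (fun t => |doubleLog 1 0 1 t| ^ p) zero_le_one, avg_abs_doubleLog_rpow hp,
    Real.Gamma_add_one hp.ne']
  ring

end

theorem theorem1 (a b : ℝ) (hab : a < b) :
    -- the inequalities
    (∀ φ : ℝ → ℝ, MemBMO φ a b → bmoNorm φ a b ≠ 0 →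
      (∀ p : ℝ, 0 < p → IntegrableOn (fun t => |φ t - avg φ a b| ^ p) (Ioo a b)) ∧
      (∀ p : ℝ, 0 < p → p ≤ 1 →
        (2 : ℝ) ^ (p - 2) * bmoNorm φ a b ^ (p - 2) * osc2 φ a b ≤ pOsc p φ a b ∧
        pOsc p φ a b ≤ osc2 φ a b ^ (p / 2)) ∧
      (∀ p : ℝ, 1 ≤ p → p ≤ 2 →
        p / 2 * Real.Gamma p * bmoNorm φ a b ^ (p - 2) * osc2 φ a b ≤ pOsc p φ a b ∧
        pOsc p φ a b ≤ osc2 φ a b ^ (p / 2)) ∧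
      (∀ p : ℝ, 2 ≤ p →
        osc2 φ a b ^ (p / 2) ≤ pOsc p φ a b ∧
        pOsc p φ a b ≤ p / 2 * Real.Gamma p * bmoNorm φ a b ^ (p - 2) * osc2 φ a b)) ∧
    -- each of them is attained, for every value of the norm and every exponent in its range
    (∀ ε : ℝ, 0 < ε →
      (MemBMO (twoStep ε a b) a b ∧ bmoNorm (twoStep ε a b) a b = ε ∧
        osc2 (twoStep ε a b) a b = ε ^ 2 ∧
        ∀ p : ℝ, 0 < p →
          pOsc p (twoStep ε a b) a b = osc2 (twoStep ε a b) a b ^ (p / 2)) ∧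
      (MemBMO (doubleLog ε a b) a b ∧ bmoNorm (doubleLog ε a b) a b = ε ∧
        osc2 (doubleLog ε a b) a b = ε ^ 2 ∧
        ∀ p : ℝ, 1 ≤ p →
          pOsc p (doubleLog ε a b) a b =
            p / 2 * Real.Gamma p * bmoNorm (doubleLog ε a b) a b ^ (p - 2) *
              osc2 (doubleLog ε a b) a b) ∧
      (MemBMO (threeStep ε a b) a b ∧ bmoNorm (threeStep ε a b) a b = ε ∧
        osc2 (threeStep ε a b) a b = ε ^ 2 ∧
        ∀ p : ℝ, 0 < p → p ≤ 1 →
          pOsc p (threeStep ε a b) a b =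
            (2 : ℝ) ^ (p - 2) * bmoNorm (threeStep ε a b) a b ^ (p - 2) *
              osc2 (threeStep ε a b) a b)) := by

  refine ⟨fun φ hφ hN => ?_, fun ε hε => ⟨?_, ?_, ?_⟩⟩
  · have hN := (bmoNorm_nonneg φ a b).lt_of_ne' hN
    have h := hφ.oscBoundedBy hab
    exact ⟨fun p hp => h.integrable_deviation_rpow hN hab hp,
      fun p hp hp' => ⟨h.le_pOsc_of_le_one hN hab hp hp',
        h.pOsc_le_osc2_rpow hN hab hp (by linarith)⟩,
      fun p hp hp' => ⟨h.le_pOsc hN hab hp hp', h.pOsc_le_osc2_rpow hN hab (by linarith) hp'⟩,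
      fun p hp => ⟨h.osc2_rpow_le_pOsc hN hab hp, h.pOsc_le hN hab hp⟩⟩
  · obtain ⟨h₁, h₂, h₃, h₄⟩ :=
      (oscBoundedBy_twoStep hε).comp_affine hε (osc2_twoStep hε) hab
    rw [← twoStep_eq] at h₁ h₂ h₃ h₄
    refine ⟨h₁, h₂, h₃, fun p _ => ?_⟩
    rw [h₄, h₃, pOsc_twoStep hε, ← abs_of_pos hε, sq_abs_rpow_half]
  · obtain ⟨h₁, h₂, h₃, h₄⟩ :=
      (oscBoundedBy_doubleLog ε).comp_affine hε (osc2_doubleLog ε) hab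
    rw [← doubleLog_eq] at h₁ h₂ h₃ h₄
    refine ⟨h₁, h₂, h₃, fun p hp => ?_⟩
    rw [h₄, h₃, h₂, pOsc_doubleLog hε (by linarith), mul_assoc, ← Real.rpow_two ε,
      ← Real.rpow_add hε, sub_add_cancel]
    ring
  · obtain ⟨h₁, h₂, h₃, h₄⟩ :=
      (oscBoundedBy_threeStep ε).comp_affine hε (osc2_threeStep ε) hab
    rw [← threeStep_eq] at h₁ h₂ h₃ h₄
    refine ⟨h₁, h₂, h₃, fun p hp _ => ?_⟩
    rw [h₄, h₃, h₂, pOsc_threeStep hε hp, ← Real.mul_rpow two_pos.le hε.le,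
      Real.rpow_sub (by positivity), Real.rpow_two]
    field_simp
    norm_num
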